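/- Let $G$ be a finite simple graph, not necessarily connected, that is $d$-regular for some integer $d \ge 1$ (every vertex has exactly $d$ neighbours). Then $G$ admits an antimagic orientation: there are an orientation $D$ of $G$ (each edge $uv$ of $G$ is replaced by exactly one of the two arcs $(u,v)$, $(v,u)$) and a bijection $c$ from the arc set $A(D)$ to $\{1, 2, \dots, |A(D)|\}$ such that the vertex sums $$ s(u) \;=\; \sum_{(w,u) \in A(D)} c(w,u) \;-\; \sum_{(u,w) \in A(D)} c(u,w) \qquad (u \in V(G)) $$ are pairwise distinct. -/

import Mathlib

namespace Digraph

variable {V : Type*}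

/-- The set of arcs of a digraph; the arc from `u` to `v` is the pair `(u, v)`. -/
def arcs (D : Digraph V) : Set (V × V) := {a | D.Adj a.1 a.2}

/-- `D` is an orientation of the simple graph `G`: every edge of `G` is replaced by exactly one of
the two possible arcs, and `D` has no other arcs. -/
def IsOrientationOf (D : Digraph V) (G : SimpleGraph V) : Prop :=
  (∀ u v, G.Adj u v ↔ D.Adj u v ∨ D.Adj v u) ∧ ∀ u v, D.Adj u v → ¬ D.Adj v u

open Classical in
/-- The sum of the labels of all arcs entering `u` minus the sum of the labels of all arcs
leaving `u`. -/
noncomputable def vertexSum [Fintype V] (D : Digraph V) (label : V × V → ℕ) (u : V) : ℤ :=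
  (∑ w : V with D.Adj w u, (label (w, u) : ℤ)) - ∑ w : V with D.Adj u w, (label (u, w) : ℤ)

/-- `label` restricts to a bijection from the arcs of `D` to `{1, …, |A(D)|}` such that distinct
vertices have distinct vertex sums. The values of `label` outside the arcs play no role. -/
def IsAntimagicLabeling [Fintype V] (D : Digraph V) (label : V × V → ℕ) : Prop :=
  Set.BijOn label D.arcs (Set.Icc 1 D.arcs.ncard) ∧ Function.Injective (D.vertexSum label)

/-- A digraph is antimagic if it has an antimagic labeling. -/
def IsAntimagic [Fintype V] (D : Digraph V) : Prop :=
  ∃ label : V × V → ℕ, D.IsAntimagicLabeling label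

end Digraph

/-- Some orientation of `G` is antimagic. -/
def SimpleGraph.HasAntimagicOrientation {V : Type*} [Fintype V] (G : SimpleGraph V) : Prop :=
  ∃ D : Digraph V, D.IsOrientationOf G ∧ D.IsAntimagic

set_option linter.unusedSectionVars false

open Finset

/-! Number the arcs of a directed trail consecutively: a passage through a vertex, in by label `j`
and out by `j + 1`, contributes -1 to its sum. So if trails covering `G` are labelled one after
another, twice the vertex sum plus the degree depends only on the trails starting or ending at the
vertex: a trail with labels `p + 1, …, q` gives `2 * q + 1` at its target and `-(2 * p + 1)` at its
source (`exists_orientation_of_trails`). The degree being constant, these end contributions have to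
be made distinct. The trails come from a decomposition into as few trails as possible, in which no
two can be merged.

Odd degree: every vertex is an end of exactly one trail, so all contributions differ.

Even degree `2 * k`: the trails are closed and vertex-disjoint. Cut at first visits
(`exists_cyclic_trails`), they become cycles of pieces, with each vertex the junction of two
consecutive pieces. Reverse every second piece: then both pieces at a vertex end there or both start
there, except at one vertex of each cycle with an odd number of pieces. The order `trailKey` makes
any two ordinary vertices of equal sign comparable (`trailKey_comparable`), hence their sums
distinct. At an exceptional vertex the sum is a difference. For `k ≥ 2` first pieces have length one
and last pieces at least two, so placing the first pieces of all odd cycles before all their last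
pieces makes these differences strictly increasing, and they stay below the other positive sums.

For `k = 1` all pieces are single edges and those differences would coincide, so cycles receive the
explicit labels `cycleLabel`. Sums on odd cycles are separated by parity and size, apart from
coincidences in pairs at exceptional vertices; these are resolved by opposite signs, some odd cycles
being oriented the other way. -/

theorem exists_perm_cons_of_mem {α : Type*} {a : α} {l : List α} (h : a ∈ l) :
    ∃ R, l.Perm (a :: R) :=
  let ⟨_, _, h⟩ := List.append_of_mem h; ⟨_, h ▸ List.perm_middle⟩

/-! ### Directed walks and trails -/

/-- `IsDartChain u w l`: the list of arcs `l` is a directed walk from `u` to `w`. -/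
def IsDartChain {V : Type*} : V → V → List (V × V) → Prop
  | u, w, [] => u = w
  | u, w, d :: l => d.1 = u ∧ IsDartChain d.2 w l

section IsDartChain

variable {V : Type*}

theorem isDartChain_append {u w : V} {l₁ l₂ : List (V × V)} :
    IsDartChain u w (l₁ ++ l₂) ↔ ∃ x, IsDartChain u x l₁ ∧ IsDartChain x w l₂ := by
  induction l₁ generalizing u with
  | nil => simp [IsDartChain]
  | cons d l ih => simp [IsDartChain, ih, and_assoc]

theorem IsDartChain.append {u x w : V} {l₁ l₂ : List (V × V)} (h₁ : IsDartChain u x l₁)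
    (h₂ : IsDartChain x w l₂) : IsDartChain u w (l₁ ++ l₂) :=
  isDartChain_append.2 ⟨x, h₁, h₂⟩

theorem isDartChain_singleton (d : V × V) : IsDartChain d.1 d.2 [d] := ⟨rfl, rfl⟩

theorem IsDartChain.reverse {u w : V} {l : List (V × V)} (h : IsDartChain u w l) :
    IsDartChain w u (l.map Prod.swap).reverse := by
  induction l generalizing u with
  | nil => exact h.symm
  | cons d l ih =>
    obtain ⟨rfl, h⟩ := h
    simp only [List.map_cons, List.reverse_cons]
    exact (ih h).append ⟨rfl, rfl⟩

theorem IsDartChain.exists_split {u w v : V} {l : List (V × V)} (h : IsDartChain u w l)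
    (hv : ∃ d ∈ l, d.1 = v) :
    ∃ l₁ l₂, l = l₁ ++ l₂ ∧ l₂ ≠ [] ∧ IsDartChain u v l₁ ∧ IsDartChain v w l₂ := by
  obtain ⟨d, hd, rfl⟩ := hv
  obtain ⟨l₁, l₂, rfl⟩ := List.append_of_mem hd
  obtain ⟨x, h₁, h₂⟩ := isDartChain_append.1 h
  obtain rfl : d.1 = x := h₂.1
  exact ⟨l₁, d :: l₂, rfl, by simp, h₁, h₂⟩

end IsDartChain

/-- A nonempty directed walk, recorded by its list of arcs. -/
structure Trail (V : Type*) where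
  src : V
  tgt : V
  darts : List (V × V)
  ne_nil : darts ≠ []
  chain : IsDartChain src tgt darts

namespace Trail

variable {V : Type*}

/-- The unoriented edges of a trail. -/
def edges (t : Trail V) : Multiset (Sym2 V) :=
  ((t.darts.map fun d => s(d.1, d.2) : List (Sym2 V)) : Multiset (Sym2 V))

/-- The trail traversed backwards. -/
def reverse (t : Trail V) : Trail V where
  src := t.tgt
  tgt := t.src
  darts := (t.darts.map Prod.swap).reverse
  ne_nil := by simpa using t.ne_nil
  chain := t.chain.reverse

theorem edges_reverse (t : Trail V) : t.reverse.edges = t.edges := by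
  simp only [edges, reverse, List.map_reverse, Multiset.coe_reverse, List.map_map]
  congr 2
  funext d
  exact Sym2.eq_swap

theorem length_pos (t : Trail V) : 0 < t.darts.length :=
  List.length_pos_iff.2 t.ne_nil

theorem exists_dart_fst_eq_src (t : Trail V) : ∃ d ∈ t.darts, d.1 = t.src := by
  obtain ⟨u, w, l, hne, h⟩ := t
  cases l with
  | nil => exact absurd rfl hne
  | cons d l => exact ⟨d, by simp, h.1⟩

/-- Every head of an arc of a closed trail is the tail of an arc. -/
theorem exists_dart_fst_eq_snd {t : Trail V} (ht : t.src = t.tgt) {d : V × V}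
    (hd : d ∈ t.darts) : ∃ d' ∈ t.darts, d'.1 = d.2 := by
  obtain ⟨l₁, l₂, h⟩ := List.append_of_mem hd
  have hc := t.chain
  rw [h] at hc
  obtain ⟨x, h₁, h₂⟩ := isDartChain_append.1 hc
  cases l₂ with
  | nil =>
    obtain ⟨d', hd', h'⟩ := t.exists_dart_fst_eq_src
    exact ⟨d', hd', h'.trans (ht.trans h₂.2.symm)⟩
  | cons d' l₂ => exact ⟨d', by simp [h], h₂.2.1⟩

end Trail

/-! ### Decompositions into the fewest trails -/

section Decomposition

variable {V : Type*} [Fintype V] [DecidableEq V] (G : SimpleGraph V) [DecidableRel G.Adj]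

/-- The trails in the list `L` together use every edge of `G` exactly once and no other edge. -/
def IsTrailDecomposition (L : List (Trail V)) : Prop :=
  (L.map Trail.edges).sum = G.edgeFinset.val

variable {G}

theorem IsTrailDecomposition.perm {L L' : List (Trail V)} (h : IsTrailDecomposition G L)
    (hp : L.Perm L') : IsTrailDecomposition G L' := by
  unfold IsTrailDecomposition at *
  rw [← h]
  exact (hp.map _).sum_eq.symm

theorem exists_isTrailDecomposition : ∃ L, IsTrailDecomposition G L := by
  have hs (e : Sym2 V) : ∃ t : Trail V, t.edges = {e} := by
    induction e using Sym2.ind with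
    | _ u w => exact ⟨⟨u, w, [(u, w)], by simp, isDartChain_singleton (u, w)⟩, rfl⟩
  choose f hf using hs
  refine ⟨G.edgeFinset.toList.map f, ?_⟩
  unfold IsTrailDecomposition
  rw [List.map_map, show Trail.edges ∘ f = fun e => {e} from funext hf]
  conv_rhs => rw [← Finset.coe_toList]
  generalize G.edgeFinset.toList = l
  induction l with
  | nil => rfl
  | cons e l ih => rw [List.map_cons, List.sum_cons, ih]; rfl

variable (G) in
/-- A decomposition into as few trails as possible. -/
def IsMinTrailDecomposition (L : List (Trail V)) : Prop :=
  IsTrailDecomposition G L ∧ ∀ L', IsTrailDecomposition G L' → L.length ≤ L'.length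

theorem exists_isMinTrailDecomposition : ∃ L, IsMinTrailDecomposition G L := by
  classical
  have h : ∃ n, ∃ L, IsTrailDecomposition G L ∧ L.length = n :=
    let ⟨L, hL⟩ := exists_isTrailDecomposition (G := G); ⟨_, L, hL, rfl⟩
  obtain ⟨L, hL, hn⟩ := Nat.find_spec h
  exact ⟨L, hL, fun L' hL' => hn ▸ Nat.find_min' h ⟨L', hL', rfl⟩⟩

/-- Minimality is used only in this form: replacing two trails by one would shorten the
decomposition. -/
theorem IsMinTrailDecomposition.not_merge {L R : List (Trail V)} {t₁ t₂ : Trail V}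
    (h : IsMinTrailDecomposition G L) (hp : L.Perm (t₁ :: t₂ :: R)) (t : Trail V) :
    t.edges ≠ t₁.edges + t₂.edges := by
  intro he
  have h' : IsTrailDecomposition G (t :: R) := by
    have := h.1.perm hp
    unfold IsTrailDecomposition at *
    rw [← this]
    simp [he, add_assoc]
  have := h.2 _ h'
  rw [hp.length_eq] at this
  simp at this

theorem Trail.exists_join {t₁ t₂ : Trail V} (h : t₁.tgt = t₂.src) :
    ∃ t : Trail V, t.edges = t₁.edges + t₂.edges := by
  refine ⟨⟨t₁.src, t₂.tgt, t₁.darts ++ t₂.darts, by simp [t₁.ne_nil],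
    t₁.chain.append (h ▸ t₂.chain)⟩, ?_⟩
  simp [Trail.edges]

/-- The two trails have a common end. -/
def Trail.ShareEnd (t₁ t₂ : Trail V) : Prop :=
  t₁.src = t₂.src ∨ t₁.src = t₂.tgt ∨ t₁.tgt = t₂.src ∨ t₁.tgt = t₂.tgt

theorem Trail.ShareEnd.exists_join {t₁ t₂ : Trail V} (h : t₁.ShareEnd t₂) :
    ∃ t : Trail V, t.edges = t₁.edges + t₂.edges := by
  rcases h with h | h | h | h
  · rw [← t₁.edges_reverse]
    exact Trail.exists_join h
  · rw [add_comm]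
    exact Trail.exists_join h.symm
  · exact Trail.exists_join h
  · rw [← t₂.edges_reverse]
    exact Trail.exists_join h

/-- The closed trail, rotated so that it starts at `v`, is spliced into the other one at a visit of
`v`. -/
theorem Trail.exists_join_of_closed {t₁ t₂ : Trail V} (h₁ : t₁.src = t₁.tgt) {v : V}
    (hv₁ : ∃ d ∈ t₁.darts, d.1 = v) (hv₂ : ∃ d ∈ t₂.darts, d.1 = v) :
    ∃ t : Trail V, t.edges = t₁.edges + t₂.edges := by
  obtain ⟨a, b, hab, -, ha, hb⟩ := t₁.chain.exists_split hv₁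
  obtain ⟨c, e, hce, he, hc, he'⟩ := t₂.chain.exists_split hv₂
  refine ⟨⟨t₂.src, t₂.tgt, c ++ (b ++ a) ++ e, by simp [he],
    (hc.append (hb.append (h₁ ▸ ha))).append he'⟩, ?_⟩
  simp only [Trail.edges, hab, hce, List.map_append, ← Multiset.coe_add]
  abel

theorem pairwise_of_perm_cons_cons {α : Type*} {P : α → α → Prop} {L : List α}
    (h : ∀ a b R, L.Perm (a :: b :: R) → P a b) : L.Pairwise P := by
  induction L with
  | nil => exact List.Pairwise.nil
  | cons x L ih =>
    refine List.pairwise_cons.2 ⟨fun y hy => ?_, ih fun a b R hR => ?_⟩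
    · obtain ⟨R, hR⟩ := exists_perm_cons_of_mem hy
      exact h _ _ R (hR.cons x)
    · refine h a b (x :: R) ((hR.cons x).trans ?_)
      exact (List.Perm.swap a x _).trans ((List.Perm.swap b x _).cons a)

theorem IsMinTrailDecomposition.not_shareEnd {L R : List (Trail V)} {t₁ t₂ : Trail V}
    (h : IsMinTrailDecomposition G L) (hp : L.Perm (t₁ :: t₂ :: R)) : ¬ t₁.ShareEnd t₂ :=
  fun hs => let ⟨t, ht⟩ := hs.exists_join; h.not_merge hp t ht

/-- The number of arcs of the trail that enter `v` plus the number that leave `v`. -/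
def Trail.visits (t : Trail V) (v : V) : ℕ :=
  t.darts.countP (fun d => d.2 = v) + t.darts.countP (fun d => d.1 = v)

/-- Every arrival at `v` is followed by a departure, except possibly at the ends of the walk. -/
theorem IsDartChain.countP_add {u w : V} {l : List (V × V)} (h : IsDartChain u w l) (v : V) :
    l.countP (fun d => d.2 = v) + (if u = v then 1 else 0) =
      l.countP (fun d => d.1 = v) + (if w = v then 1 else 0) := by
  induction l generalizing u with
  | nil => obtain rfl : u = w := h; rfl
  | cons d l ih =>
    obtain ⟨rfl, h⟩ := h
    have := ih h
    simp only [List.countP_cons, decide_eq_true_eq]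
    omega

theorem IsTrailDecomposition.adj_of_mem {L : List (Trail V)} (h : IsTrailDecomposition G L)
    {t : Trail V} (ht : t ∈ L) {d : V × V} (hd : d ∈ t.darts) : G.Adj d.1 d.2 := by
  have h1 : s(d.1, d.2) ∈ (L.map Trail.edges).sum := by
    obtain ⟨R, hR⟩ := exists_perm_cons_of_mem ht
    rw [(hR.map _).sum_eq, List.map_cons, List.sum_cons]
    exact Multiset.mem_add.2 (Or.inl (by
      simp only [Trail.edges, Multiset.mem_coe, List.mem_map]; exact ⟨d, hd, rfl⟩))
  rw [h] at h1
  simpa using h1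

/-- Loops must be excluded: a loop at `v` is one edge but counts twice on the right. -/
theorem countP_mem_edges (l : List (V × V)) (hl : ∀ d ∈ l, d.1 ≠ d.2) (v : V) :
    (l.map fun d => s(d.1, d.2)).countP (fun e => v ∈ e) =
      l.countP (fun d => d.2 = v) + l.countP (fun d => d.1 = v) := by
  induction l with
  | nil => rfl
  | cons d l ih =>
    have h1 := hl d (by simp)
    have := ih fun d hd => hl d (by simp [hd])
    simp only [List.map_cons, List.countP_cons, decide_eq_true_eq, Sym2.mem_iff] at *
    by_cases h2 : d.1 = v <;> by_cases h3 : d.2 = v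
    · exact absurd (h2.trans h3.symm) h1
    · simp [h2, h3, this, eq_comm]; omega
    · simp [h2, h3, this, eq_comm]; omega
    · simp [h2, h3, this, eq_comm, Ne.symm h2, Ne.symm h3]

theorem countP_edgeFinset (v : V) :
    G.edgeFinset.val.countP (fun e => v ∈ e) = G.degree v := by
  rw [← G.card_incidenceFinset_eq_degree, Multiset.countP_eq_card_filter,
    SimpleGraph.incidenceFinset_eq_filter]
  rfl

theorem IsTrailDecomposition.sum_visits {L : List (Trail V)} (h : IsTrailDecomposition G L)
    (v : V) : (L.map fun t => t.visits v).sum = G.degree v := by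
  rw [← countP_edgeFinset, ← h]
  have h' := fun t ht d hd => (h.adj_of_mem (t := t) ht (d := d) hd).ne
  clear h
  induction L with
  | nil => rfl
  | cons t L ih =>
    rw [List.map_cons, List.sum_cons, List.map_cons, List.sum_cons, Multiset.countP_add,
      ih fun t ht => h' t (by simp [ht])]
    congr 1
    rw [Trail.visits, ← countP_mem_edges _ (h' t (by simp))]
    rfl

/-- The number of ends of the trail at `v`. -/
def Trail.ends (t : Trail V) (v : V) : ℕ :=
  (if t.src = v then 1 else 0) + if t.tgt = v then 1 else 0

theorem Trail.even_visits_add_ends (t : Trail V) (v : V) : Even (t.visits v + t.ends v) := by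
  have := t.chain.countP_add v
  refine ⟨t.darts.countP (fun d => d.1 = v) + if t.tgt = v then 1 else 0, ?_⟩
  unfold Trail.visits Trail.ends
  omega

theorem IsTrailDecomposition.even_degree_add_ends {L : List (Trail V)}
    (h : IsTrailDecomposition G L) (v : V) :
    Even (G.degree v + (L.map fun t => t.ends v).sum) := by
  rw [← h.sum_visits v]
  clear h
  induction L with
  | nil => simp
  | cons t L ih =>
    have := t.even_visits_add_ends v
    simp only [List.map_cons, List.sum_cons]
    rw [add_add_add_comm]
    exact this.add ih

/-- A second trail with an end at `v` could be joined to `t`. -/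
theorem IsMinTrailDecomposition.sum_ends {L : List (Trail V)} (h : IsMinTrailDecomposition G L)
    {t : Trail V} (ht : t ∈ L) {v : V} (hv : t.ends v ≠ 0) :
    (L.map fun t => t.ends v).sum = t.ends v := by
  obtain ⟨R, hR⟩ := exists_perm_cons_of_mem ht
  rw [(hR.map _).sum_eq, List.map_cons, List.sum_cons]
  simp only [Nat.add_eq_left, List.sum_eq_zero_iff, List.mem_map]
  rintro _ ⟨t', ht', rfl⟩
  by_contra h0
  obtain ⟨R', hR'⟩ := exists_perm_cons_of_mem ht'
  apply h.not_shareEnd (hR.trans (hR'.cons t))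
  unfold Trail.ends at hv h0
  unfold Trail.ShareEnd
  by_cases h1 : t.src = v <;> by_cases h2 : t.tgt = v <;> by_cases h3 : t'.src = v <;>
    by_cases h4 : t'.tgt = v <;> simp_all

/-- By parity the number of ends at `v` is odd. All of them belong to a single trail, which has only
two ends. -/
theorem IsMinTrailDecomposition.sum_ends_of_odd {L : List (Trail V)}
    (h : IsMinTrailDecomposition G L) {v : V} (hv : Odd (G.degree v)) :
    (L.map fun t => t.ends v).sum = 1 := by
  have h1 := h.1.even_degree_add_ends v
  have h2 : Odd (L.map fun t => t.ends v).sum := by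
    by_contra h3
    exact (Nat.not_even_iff_odd.2 (hv.add_even (Nat.not_odd_iff_even.1 h3))) h1
  obtain ⟨t, ht, h0⟩ : ∃ t ∈ L, t.ends v ≠ 0 := by
    by_contra! h0
    rw [List.sum_eq_zero] at h2
    · exact absurd h2 (by decide)
    · simpa using h0
  have h3 := h.sum_ends ht h0
  rw [h3] at h2 ⊢
  have : t.ends v ≤ 2 := by unfold Trail.ends; split_ifs <;> simp
  obtain ⟨k, hk⟩ := h2
  omega

theorem IsMinTrailDecomposition.closed_of_even {L : List (Trail V)}
    (h : IsMinTrailDecomposition G L) (hG : ∀ v, Even (G.degree v)) {t : Trail V} (ht : t ∈ L) :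
    t.src = t.tgt := by
  by_contra hne
  have h1 : t.ends t.src = 1 := by simp [Trail.ends, Ne.symm hne]
  have h2 := h.1.even_degree_add_ends t.src
  rw [h.sum_ends ht (by omega), h1] at h2
  exact (Nat.not_even_iff_odd.2 ((hG t.src).add_odd odd_one)) h2

theorem IsMinTrailDecomposition.pairwise_disjoint_of_even {L : List (Trail V)}
    (h : IsMinTrailDecomposition G L) (hG : ∀ v, Even (G.degree v)) :
    L.Pairwise fun t₁ t₂ => ∀ d₁ ∈ t₁.darts, ∀ d₂ ∈ t₂.darts, d₁.1 ≠ d₂.1 := by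
  refine pairwise_of_perm_cons_cons fun t₁ t₂ R hR d₁ hd₁ d₂ hd₂ he => ?_
  obtain ⟨t, ht⟩ := Trail.exists_join_of_closed
    (h.closed_of_even hG (hR.mem_iff.2 (by simp))) ⟨d₁, hd₁, he⟩ ⟨d₂, hd₂, rfl⟩
  exact h.not_merge hR t ht

end Decomposition

/-! ### Consecutive labels along trails; odd degree -/

section Labeling

variable {V : Type*} [Fintype V] [DecidableEq V] {G : SimpleGraph V} [DecidableRel G.Adj]

/-- A family of arcs that uses every edge of `G` exactly once, together with a numbering of the
family, gives an orientation of `G` and a labeling of its arcs. -/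
theorem exists_orientation_of_arcs {ι : Type*} [Fintype ι] (a : ι → V × V)
    (ha : ∑ i, ({s((a i).1, (a i).2)} : Multiset (Sym2 V)) = G.edgeFinset.val) (num : ι → ℕ)
    (hinj : Function.Injective num) (hnum : ∀ i, 1 ≤ num i ∧ num i ≤ Fintype.card ι) :
    ∃ (D : Digraph V) (label : V × V → ℕ), D.IsOrientationOf G ∧
      Set.BijOn label D.arcs (Set.Icc 1 D.arcs.ncard) ∧
      ∀ v, D.vertexSum label v = ∑ i, (num i : ℤ) *
        ((if (a i).2 = v then 1 else 0) - if (a i).1 = v then 1 else 0) := by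
  classical
  have hmap : univ.val.map (fun i => s((a i).1, (a i).2)) = G.edgeFinset.val := by
    rw [← ha, Finset.sum, ← Multiset.sum_map_singleton (univ.val.map _), Multiset.map_map]
    rfl
  have hedge : Function.Injective fun i => s((a i).1, (a i).2) := by
    have h := G.edgeFinset.nodup
    rw [← hmap, Multiset.nodup_map_iff_inj_on univ.nodup] at h
    exact fun i j hij => h i (mem_univ i) j (mem_univ j) hij
  have hainj : Function.Injective a := fun i j hij => hedge (by simp [hij])
  have hadj (u w : V) : G.Adj u w ↔ ∃ i, s((a i).1, (a i).2) = s(u, w) := by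
    rw [← SimpleGraph.mem_edgeSet, ← SimpleGraph.mem_edgeFinset, ← Finset.mem_val, ← hmap]
    simp
  let label : V × V → ℕ := fun p => if h : ∃ i, a i = p then num h.choose else 0
  have hlabel (i : ι) : label (a i) = num i := by
    have h : ∃ j, a j = a i := ⟨i, rfl⟩
    simp only [label, dif_pos h]
    rw [hainj h.choose_spec]
  have hlabel' {i : ι} {p : V × V} (h : a i = p) : label p = num i := h ▸ hlabel i
  let D : Digraph V := ⟨fun u w => ∃ i, a i = (u, w)⟩
  have harcs : D.arcs = Set.range a := by
    ext p
    rfl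
  have hcard : D.arcs.ncard = Fintype.card ι := by
    rw [harcs, ← Set.image_univ, Set.ncard_image_of_injective _ hainj, Set.ncard_univ,
      Nat.card_eq_fintype_card]
  refine ⟨D, label, ⟨fun u w => ?_, fun u w => ?_⟩, ?_, fun v => ?_⟩
  · rw [hadj]
    constructor
    · rintro ⟨i, hi⟩
      rcases Sym2.eq_iff.1 hi with h | h
      · exact Or.inl ⟨i, Prod.ext h.1 h.2⟩
      · exact Or.inr ⟨i, Prod.ext h.1 h.2⟩
    · rintro (⟨i, hi⟩ | ⟨i, hi⟩)
      · exact ⟨i, by rw [hi]⟩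
      · exact ⟨i, by rw [hi, Sym2.eq_swap]⟩
  · rintro ⟨i, hi⟩ ⟨j, hj⟩
    obtain rfl : i = j := hedge (by simp only [hi, hj]; exact Sym2.eq_swap)
    rw [hi] at hj
    have hne : G.Adj u w := (hadj u w).2 ⟨i, by rw [hi]⟩
    exact hne.ne (Prod.ext_iff.1 hj).1
  · rw [hcard, harcs]
    have hl : Set.InjOn label (Set.range a) := by
      rintro _ ⟨i, rfl⟩ _ ⟨j, rfl⟩ hij
      rw [hlabel, hlabel] at hij
      rw [hinj hij]
    refine ⟨?_, hl, ?_⟩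
    · rintro _ ⟨i, rfl⟩
      rw [hlabel]
      exact hnum i
    · have himg : univ.image num = Finset.Icc 1 (Fintype.card ι) := by
        apply Finset.eq_of_subset_of_card_le
        · intro x hx
          obtain ⟨i, -, rfl⟩ := Finset.mem_image.1 hx
          exact Finset.mem_Icc.2 (hnum i)
        · rw [Finset.card_image_of_injective _ hinj]
          simp
      intro x hx
      have : x ∈ univ.image num := by rw [himg]; exact Finset.mem_Icc.2 hx
      obtain ⟨i, -, rfl⟩ := Finset.mem_image.1 this
      exact ⟨a i, ⟨i, rfl⟩, hlabel i⟩
  · have hin : ∑ w : V with D.Adj w v, (label (w, v) : ℤ) =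
        ∑ i, if (a i).2 = v then (num i : ℤ) else 0 := by
      rw [← Finset.sum_filter]
      symm
      refine Finset.sum_nbij (fun i => (a i).1) ?_ ?_ ?_ ?_
      · intro i hi
        exact Finset.mem_filter.2 ⟨mem_univ _, i, Prod.ext rfl (Finset.mem_filter.1 hi).2⟩
      · intro i hi j hj hij
        exact hainj (Prod.ext hij ((Finset.mem_filter.1 hi).2.trans
          (Finset.mem_filter.1 hj).2.symm))
      · intro w hw
        obtain ⟨i, hi⟩ := (Finset.mem_filter.1 hw).2
        exact ⟨i, Finset.mem_filter.2 ⟨mem_univ _, by rw [hi]⟩, by simp [hi]⟩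
      · intro i hi
        rw [hlabel' (i := i) (p := ((a i).1, v)) (Prod.ext rfl (Finset.mem_filter.1 hi).2)]
    have hout : ∑ w : V with D.Adj v w, (label (v, w) : ℤ) =
        ∑ i, if (a i).1 = v then (num i : ℤ) else 0 := by
      rw [← Finset.sum_filter]
      symm
      refine Finset.sum_nbij (fun i => (a i).2) ?_ ?_ ?_ ?_
      · intro i hi
        exact Finset.mem_filter.2 ⟨mem_univ _, i, Prod.ext (Finset.mem_filter.1 hi).2 rfl⟩
      · intro i hi j hj hij
        exact hainj (Prod.ext ((Finset.mem_filter.1 hi).2.trans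
          (Finset.mem_filter.1 hj).2.symm) hij)
      · intro w hw
        obtain ⟨i, hi⟩ := (Finset.mem_filter.1 hw).2
        exact ⟨i, Finset.mem_filter.2 ⟨mem_univ _, by rw [hi]⟩, by simp [hi]⟩
      · intro i hi
        rw [hlabel' (i := i) (p := (v, (a i).2)) (Prod.ext (Finset.mem_filter.1 hi).2 rfl)]
    have hsub : D.vertexSum label v = (∑ i, if (a i).2 = v then (num i : ℤ) else 0) -
        ∑ i, if (a i).1 = v then (num i : ℤ) else 0 := by
      rw [← hin, ← hout, Digraph.vertexSum]
      congr!
    rw [hsub, ← Finset.sum_sub_distrib]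
    refine Finset.sum_congr rfl fun i _ => ?_
    split_ifs <;> simp

/-- A passage through `v` adds -1 to the weighted sum and 2 to the number of visits, so the doubled
sum cancels it. A first arc leaves `-2 * (off + 1) + 1`, a last arc `2 * (off + l.length) + 1`. -/
theorem IsDartChain.two_mul_weighted_sum {u w : V} {l : List (V × V)} (h : IsDartChain u w l)
    (off : ℤ) (v : V) :
    2 * ∑ i : Fin l.length, (off + i + 1) *
        ((if (l[i]).2 = v then 1 else 0) - if (l[i]).1 = v then 1 else 0) +
      ((l.countP (fun d => d.2 = v) + l.countP (fun d => d.1 = v) : ℕ) : ℤ) =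
    (if w = v then 2 * (off + l.length) + 1 else 0) - if u = v then 2 * off + 1 else 0 := by
  induction l generalizing u off with
  | nil => obtain rfl : u = w := h; simp
  | cons d l ih =>
    obtain ⟨rfl, h⟩ := h
    have := ih h (off + 1)
    have hs : ∑ i : Fin (d :: l).length, (off + i + 1) *
        ((if ((d :: l)[i]).2 = v then 1 else 0) - if ((d :: l)[i]).1 = v then 1 else 0) =
        (off + 1) * ((if d.2 = v then 1 else 0) - if d.1 = v then 1 else 0) +
        ∑ i : Fin l.length, (off + 1 + i + 1) *
        ((if (l[i]).2 = v then 1 else 0) - if (l[i]).1 = v then 1 else 0) := by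
      simp only [List.length_cons]
      rw [Fin.sum_univ_succ]
      refine congrArg₂ (· + ·) ?_ (Finset.sum_congr rfl fun i _ => ?_)
      · change (off + ((0 : ℕ) : ℤ) + 1) * _ = _
        rw [Nat.cast_zero, add_zero]
        rfl
      · change (off + ((i + 1 : ℕ) : ℤ) + 1) * _ = _
        rw [show off + ((i + 1 : ℕ) : ℤ) + 1 = off + 1 + i + 1 by push_cast; ring]
        rfl
    rw [hs]
    simp only [List.countP_cons, decide_eq_true_eq, List.length_cons]
    push_cast at this ⊢
    split_ifs at this ⊢ <;> linarith

theorem sum_visits_of_sum_edges {ι : Type*} [Fintype ι] (T : ι → Trail V)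
    (hT : ∑ t, (T t).edges = G.edgeFinset.val) (v : V) :
    ∑ t, (T t).visits v = G.degree v := by
  have h : IsTrailDecomposition G (univ.toList.map T) := by
    unfold IsTrailDecomposition
    rw [← hT, List.map_map, ← Finset.sum_map_toList]
    rfl
  rw [← h.sum_visits v, List.map_map, ← Finset.sum_map_toList]
  rfl

/-- The total length of the trails that precede `t`. -/
def Trail.offset {ι : Type*} [Fintype ι] [LinearOrder ι] (T : ι → Trail V) (t : ι) : ℕ :=
  ∑ t' with t' < t, (T t').darts.length

theorem Trail.offset_add_length {ι : Type*} [Fintype ι] [LinearOrder ι] (T : ι → Trail V) (t : ι) :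
    Trail.offset T t + (T t).darts.length = ∑ t' with t' ≤ t, (T t').darts.length := by
  have : (univ.filter fun t' => t' ≤ t) = insert t (univ.filter fun t' => t' < t) := by
    ext x
    simp [le_iff_eq_or_lt]
  rw [this, Finset.sum_insert (by simp), add_comm]
  rfl

theorem Trail.offset_add_length_le {ι : Type*} [Fintype ι] [LinearOrder ι] (T : ι → Trail V)
    {t t' : ι} (h : t < t') :
    Trail.offset T t + (T t).darts.length ≤ Trail.offset T t' := by
  rw [Trail.offset_add_length]
  exact Finset.sum_le_sum_of_subset fun x hx => by
    simp only [Finset.mem_filter, mem_univ, true_and] at hx ⊢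
    exact hx.trans_lt h

/-- Labeling the arcs of a linearly ordered family of trails consecutively, the vertex sum of `v`
depends only on the degree of `v` and on the trails that start or end at `v`. -/
theorem exists_orientation_of_trails {ι : Type*} [Fintype ι] [LinearOrder ι] (T : ι → Trail V)
    (hT : ∑ t, (T t).edges = G.edgeFinset.val) :
    ∃ (D : Digraph V) (label : V × V → ℕ), D.IsOrientationOf G ∧
      Set.BijOn label D.arcs (Set.Icc 1 D.arcs.ncard) ∧
      ∀ v, 2 * D.vertexSum label v + G.degree v =
        ∑ t, ((if (T t).tgt = v then 2 * ((Trail.offset T t + (T t).darts.length : ℕ) : ℤ) + 1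
            else 0) - if (T t).src = v then 2 * (Trail.offset T t : ℤ) + 1 else 0) := by
  let κ := Σ t, Fin (T t).darts.length
  let a : κ → V × V := fun x => (T x.1).darts[x.2]
  let num : κ → ℕ := fun x => Trail.offset T x.1 + x.2 + 1
  have hlt {x y : κ} (h : x.1 < y.1) : num x < num y := by
    have h1 := Trail.offset_add_length_le T h
    have h2 := x.2.2
    simp only [num]
    omega
  have hinj : Function.Injective num := by
    rintro x y hxy
    rcases lt_trichotomy x.1 y.1 with h | h | h
    · exact absurd hxy (hlt h).ne
    · obtain ⟨t, i⟩ := x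
      obtain ⟨t', j⟩ := y
      obtain rfl : t = t' := h
      simp only [num] at hxy
      congr 1
      ext
      omega
    · exact absurd hxy (hlt h).ne'
  have hcard : Fintype.card κ = ∑ t, (T t).darts.length := by
    simp [κ]
  have hnum (x : κ) : 1 ≤ num x ∧ num x ≤ Fintype.card κ := by
    refine ⟨by simp only [num]; omega, ?_⟩
    have h1 := Trail.offset_add_length T x.1
    have h2 := x.2.2
    have h3 : ∑ t' with t' ≤ x.1, (T t').darts.length ≤ ∑ t, (T t).darts.length :=
      Finset.sum_le_sum_of_subset (Finset.subset_univ _)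
    rw [hcard]
    simp only [num]
    omega
  have ha : ∑ i, ({s((a i).1, (a i).2)} : Multiset (Sym2 V)) = G.edgeFinset.val := by
    rw [← hT, Fintype.sum_sigma]
    refine Finset.sum_congr rfl fun t _ => ?_
    simp only [a]
    have : ∑ i : Fin (T t).darts.length,
        ({s(((T t).darts[i]).1, ((T t).darts[i]).2)} : Multiset (Sym2 V)) =
        ((univ.val.map fun i : Fin (T t).darts.length => (T t).darts[i]).map fun d =>
          ({s(d.1, d.2)} : Multiset (Sym2 V))).sum := by
      rw [Multiset.map_map]
      rfl
    rw [this, Fin.univ_val_map, Trail.edges]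
    rw [show (List.ofFn fun i : Fin (T t).darts.length => (T t).darts[i]) = (T t).darts from
      List.ofFn_getElem, ← Multiset.map_coe,
      ← Multiset.sum_map_singleton (Multiset.map (fun d : V × V => s(d.1, d.2)) _),
      Multiset.map_map]
    rfl
  obtain ⟨D, label, hD, hl, hs⟩ := exists_orientation_of_arcs a ha num hinj hnum
  refine ⟨D, label, hD, hl, fun v => ?_⟩
  rw [hs, ← sum_visits_of_sum_edges T hT v, Fintype.sum_sigma, Finset.mul_sum, Nat.cast_sum,
    ← Finset.sum_add_distrib]
  refine Finset.sum_congr rfl fun t _ => ?_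
  have := (T t).chain.two_mul_weighted_sum (Trail.offset T t) v
  push_cast at this ⊢
  rw [← this]
  simp only [num, a, Trail.visits]
  push_cast
  rfl

theorem sum_getElem {α M : Type*} [AddCommMonoid M] (L : List α) (f : α → M) :
    ∑ i : Fin L.length, f L[i] = (L.map f).sum := by
  rw [← List.sum_ofFn]
  congr 1
  exact List.ext_getElem (by simp) (by simp)

/-- The shifted sums are positive at targets and negative at sources. Both bounds of the label
interval strictly increase along the trails, so the value determines the trail and which of its ends
the vertex is. -/
theorem hasAntimagicOrientation_of_odd (hG : ∃ d, Odd d ∧ G.IsRegularOfDegree d) :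
    G.HasAntimagicOrientation := by
  obtain ⟨d, hd, hG⟩ := hG
  obtain ⟨L, hL⟩ := exists_isMinTrailDecomposition (G := G)
  let T : Fin L.length → Trail V := fun i => L[i]
  have hT : ∑ t, (T t).edges = G.edgeFinset.val := (sum_getElem L _).trans hL.1
  have hends (v : V) : ∑ t, (T t).ends v = 1 :=
    (sum_getElem L fun t => t.ends v).trans (hL.sum_ends_of_odd (by rwa [hG v]))
  obtain ⟨D, label, hD, hl, hs⟩ := exists_orientation_of_trails T hT
  refine ⟨D, hD, label, hl, fun u w huw => ?_⟩
  have key (v : V) : ∃ t,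
      ((T t).tgt = v ∧ 2 * D.vertexSum label v + d =
        2 * ((Trail.offset T t + (T t).darts.length : ℕ) : ℤ) + 1) ∨
      ((T t).src = v ∧ 2 * D.vertexSum label v + d = -(2 * (Trail.offset T t : ℤ) + 1)) := by
    obtain ⟨t, -, hne⟩ := Finset.exists_ne_zero_of_sum_ne_zero (s := univ)
      (f := fun t => (T t).ends v) (by rw [hends v]; exact one_ne_zero)
    have hsplit := Finset.add_sum_erase univ (fun t => (T t).ends v) (mem_univ t)
    rw [hends v] at hsplit
    have ht : (T t).ends v = 1 := by omega
    have h0 : ∀ t' ∈ univ, t' ≠ t → (T t').ends v = 0 := fun t' _ hne' => by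
      have hz : ∑ t' ∈ univ.erase t, (T t').ends v = 0 := by omega
      exact Finset.sum_eq_zero_iff.1 hz t' (Finset.mem_erase.2 ⟨hne', mem_univ _⟩)
    refine ⟨t, ?_⟩
    have h := hs v
    rw [hG v, Finset.sum_eq_single t] at h
    · unfold Trail.ends at ht
      by_cases h1 : (T t).src = v <;> by_cases h2 : (T t).tgt = v <;>
        simp only [h1, h2, if_true, if_false] at ht h
      · omega
      · exact Or.inr ⟨h1, by rw [h]; ring⟩
      · exact Or.inl ⟨h2, by rw [h]; ring⟩
      · omega
    · intro t' _ hne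
      have := h0 t' (mem_univ _) hne
      unfold Trail.ends at this
      by_cases h1 : (T t').src = v <;> by_cases h2 : (T t').tgt = v <;> simp_all
    · simp
  obtain ⟨t, ht⟩ := key u
  obtain ⟨t', ht'⟩ := key w
  rw [huw] at ht
  have hpos := (T t).length_pos
  have hpos' := (T t').length_pos
  have htt : t = t' := by
    rcases lt_trichotomy t t' with h | h | h
    · have := Trail.offset_add_length_le T h
      omega
    · exact h
    · have := Trail.offset_add_length_le T h
      omega
  subst htt
  rcases ht with ⟨h1, h2⟩ | ⟨h1, h2⟩ <;> rcases ht' with ⟨h3, h4⟩ | ⟨h3, h4⟩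
  · exact h1.symm.trans h3
  · omega
  · omega
  · exact h1.symm.trans h3

end Labeling

/-! ### Cutting closed trails into cycles of pieces -/

section Cut

variable {V : Type*} [Fintype V] [DecidableEq V] {G : SimpleGraph V} [DecidableRel G.Adj]

/-- A walk is cut at the first visit of each of its vertices. -/
theorem IsDartChain.exists_cut {u w : V} {l : List (V × V)} (h : IsDartChain u w l) (hl : l ≠ [])
    (hloop : ∀ d ∈ l, d.1 ≠ d.2) :
    ∃ S : List (Trail V), S ≠ [] ∧ (S.map Trail.darts).flatten = l ∧ (S.map Trail.src).Nodup ∧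
      (∀ d ∈ l, d.1 ∈ S.map Trail.src) ∧ (∀ s ∈ S, ∃ d ∈ l, d.1 = s.src) ∧
      S.IsChain (fun a b => a.tgt = b.src) ∧
      (∀ s ∈ S.head?, s.src = u ∧ s.darts.length = 1) ∧
      (∀ s ∈ S.getLast?, s.tgt = w ∧
        ∀ l' d, l = l' ++ [d] → (∃ d' ∈ l', d'.1 = d.1) → 2 ≤ s.darts.length) := by
  induction l using List.reverseRecOn generalizing w with
  | nil => exact absurd rfl hl
  | append_singleton l d ih =>
    obtain ⟨x, hx, hd⟩ := isDartChain_append.1 h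
    obtain ⟨rfl, rfl⟩ : d.1 = x ∧ d.2 = w := hd
    by_cases hnil : l = []
    · subst hnil
      obtain rfl : u = d.1 := hx
      refine ⟨[⟨d.1, d.2, [d], by simp, isDartChain_singleton d⟩], ?_⟩
      simp only [ne_eq, List.cons_ne_self, not_false_eq_true, List.map_cons, List.map_nil,
        List.flatten_cons, List.flatten_nil, List.append_nil, List.nil_append, List.nodup_singleton,
        List.mem_singleton, List.isChain_singleton, List.head?_cons, List.getLast?_singleton,
        Option.mem_def, Option.some.injEq, true_and, forall_eq, exists_eq_left]
      refine ⟨by rintro _ rfl; simp, ?_⟩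
      rintro _ rfl
      refine ⟨rfl, fun l' e he hex => ?_⟩
      obtain ⟨rfl, -⟩ := List.append_inj' (s₁ := []) he rfl
      simp at hex
    obtain ⟨S, hne, hflat, hnd, hmem, hmem', hch, hhead, hlast⟩ :=
      ih hx hnil fun d hd => hloop d (by simp [hd])
    obtain ⟨R, s, rfl⟩ := List.eq_nil_or_concat' S |>.resolve_left hne
    have hs := hlast s (by simp)
    -- An arc whose tail was already a tail prolongs the last piece; otherwise it opens a new piece.
    by_cases hseen : ∃ d' ∈ l, d'.1 = d.1
    · let s' : Trail V := ⟨s.src, d.2, s.darts ++ [d], by simp,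
        s.chain.append (hs.1 ▸ isDartChain_singleton d)⟩
      have hsrc : (R ++ [s']).map Trail.src = (R ++ [s]).map Trail.src := by simp [s']
      -- The first piece is never prolonged: it would consist of one arc, and returning to its tail
      -- at once would make that arc a loop.
      have hR : R ≠ [] := by
        rintro rfl
        have h1 := (hhead s (by simp)).2
        obtain ⟨e, he⟩ := List.length_eq_one_iff.1 h1
        have hle : l = [e] := by rw [← hflat, ← he]; simp
        subst hle
        obtain ⟨d', hd', h'⟩ := hseen
        obtain rfl : d' = e := by simpa using hd'
        exact hloop d' (by simp) (h'.trans hx.2.symm)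
      refine ⟨R ++ [s'], by simp, ?_, hsrc ▸ hnd, ?_, ?_, ?_, ?_, ?_⟩
      · rw [← hflat]
        simp [s']
      · rw [hsrc]
        intro e he
        rcases List.mem_append.1 he with he | he
        · exact hmem e he
        · obtain rfl : e = d := by simpa using he
          obtain ⟨d', hd', h'⟩ := hseen
          exact h' ▸ hmem d' hd'
      · intro e he
        have : e.src ∈ (R ++ [s']).map Trail.src := List.mem_map_of_mem he
        rw [hsrc] at this
        obtain ⟨e', he', h'⟩ := List.mem_map.1 this
        obtain ⟨d', hd', h''⟩ := hmem' e' he'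
        exact ⟨d', by simp [hd'], h''.trans h'⟩
      · rw [List.isChain_append] at hch ⊢
        refine ⟨hch.1, by simp, fun a ha b hb => ?_⟩
        obtain rfl : s' = b := by simpa using hb
        exact hch.2.2 a ha s (by simp)
      · intro a ha
        refine hhead a ?_
        rwa [List.head?_append_of_ne_nil _ hR] at ha ⊢
      · intro a ha
        obtain rfl : s' = a := by simpa using ha
        refine ⟨rfl, fun _ _ _ _ => ?_⟩
        have := s.length_pos
        simp only [s', List.length_append, List.length_singleton]
        omega
    · refine ⟨R ++ [s] ++ [⟨d.1, d.2, [d], by simp, isDartChain_singleton d⟩], by simp, ?_, ?_, ?_,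
        ?_, ?_, ?_, ?_⟩
      · rw [← hflat]
        simp
      · rw [List.map_append, List.nodup_append]
        refine ⟨hnd, by simp, ?_⟩
        rintro a ha b hb rfl
        obtain rfl : a = d.1 := by simpa using hb
        obtain ⟨e, he, h'⟩ := List.mem_map.1 ha
        obtain ⟨d', hd', h''⟩ := hmem' e he
        exact hseen ⟨d', hd', h''.trans h'⟩
      · intro e he
        rw [List.map_append]
        rcases List.mem_append.1 he with he | he
        · exact List.mem_append_left _ (hmem e he)
        · obtain rfl : e = d := by simpa using he
          simp
      · intro e he
        rcases List.mem_append.1 he with he | he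
        · obtain ⟨d', hd', h'⟩ := hmem' e he
          exact ⟨d', by simp [hd'], h'⟩
        · refine ⟨d, by simp, ?_⟩
          rw [List.mem_singleton.1 he]
      · rw [List.isChain_append]
        refine ⟨hch, by simp, fun a ha b hb => ?_⟩
        obtain rfl : s = a := by simpa using ha
        simp only [List.head?_cons, Option.mem_def, Option.some.injEq] at hb
        rw [← hb]
        exact hs.1
      · intro a ha
        refine hhead a ?_
        rwa [List.head?_append_of_ne_nil _ (by simp)] at ha
      · intro a ha
        simp only [List.getLast?_append, List.getLast?_singleton, Option.mem_def] at ha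
        obtain rfl := Option.some.inj ha
        refine ⟨rfl, fun l' d' hld hex => ?_⟩
        obtain ⟨rfl, hdd⟩ := List.append_inj' hld rfl
        obtain rfl : d = d' := by simpa using hdd
        exact absurd hex hseen

/-- A `2 * k`-regular graph is decomposed into trails `T ⟨c, i⟩` such that every vertex is the
source of exactly one of them, and for each `c` they follow each other cyclically. The cycles with
an odd number of trails come first. -/
theorem exists_cyclic_trails {k : ℕ} (hk : 1 ≤ k) (hG : G.IsRegularOfDegree (2 * k)) :
    ∃ (N r : ℕ) (n : Fin N → ℕ) (T : (Σ c, Fin (n c)) → Trail V), r ≤ N ∧ (∀ c, 2 ≤ n c) ∧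
      (∀ c, c.val < r ↔ Odd (n c)) ∧ ∑ t, (T t).edges = G.edgeFinset.val ∧
      Function.Bijective (fun t => (T t).src) ∧
      (∀ c (i j : Fin (n c)), (j.val = i.val + 1 ∨ i.val + 1 = n c ∧ j.val = 0) →
        (T ⟨c, i⟩).tgt = (T ⟨c, j⟩).src) ∧
      (∀ c (i : Fin (n c)), i.val = 0 → (T ⟨c, i⟩).darts.length = 1) ∧
      (2 ≤ k → ∀ c (i : Fin (n c)), i.val + 1 = n c → 2 ≤ (T ⟨c, i⟩).darts.length) := by
  have heven (v : V) : Even (G.degree v) := by rw [hG v]; exact even_two_mul k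
  obtain ⟨L, hL⟩ := exists_isMinTrailDecomposition (G := G)
  have hdisj := hL.pairwise_disjoint_of_even heven
  have hcut (t : Trail V) : ∃ S : List (Trail V), t ∈ L → 2 ≤ S.length ∧
      (S.map Trail.edges).sum = t.edges ∧ (S.map Trail.src).Nodup ∧
      (∀ d ∈ t.darts, d.1 ∈ S.map Trail.src) ∧ (∀ s ∈ S, ∃ d ∈ t.darts, d.1 = s.src) ∧
      (∀ i j (hi : i < S.length) (hj : j < S.length),
        (j = i + 1 ∨ i + 1 = S.length ∧ j = 0) → S[i].tgt = S[j].src) ∧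
      (∀ i (hi : i < S.length), i = 0 → S[i].darts.length = 1) ∧
      (2 ≤ k → ∀ i (hi : i < S.length), i + 1 = S.length → 2 ≤ S[i].darts.length) := by
    by_cases ht : t ∈ L
    swap
    · exact ⟨[], fun h => absurd h ht⟩
    have hloop := fun d hd => (hL.1.adj_of_mem ht (d := d) hd).ne
    have hcl := hL.closed_of_even heven ht
    obtain ⟨S, hne, hflat, hnd, hmem, hmem', hch, hhead, hlast⟩ :=
      t.chain.exists_cut t.ne_nil hloop
    have hpos : 0 < S.length := List.length_pos_iff.2 hne
    have hhead' := hhead S[0] (by simp [List.head?_eq_getElem?])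
    have hlast' := hlast S[S.length - 1] (by
      rw [List.getLast?_eq_getElem?, List.getElem?_eq_getElem (by omega)]; rfl)
    refine ⟨S, fun _ => ⟨?_, ?_, hnd, hmem, hmem', ?_, ?_, ?_⟩⟩
    -- With a single piece all tails coincide, and since the trail is closed its first arc would be
    -- a loop.
    · by_contra hlt
      obtain ⟨s, rfl⟩ := List.length_eq_one_iff.1 (show S.length = 1 by omega)
      obtain ⟨d, hd, -⟩ := t.exists_dart_fst_eq_src
      obtain ⟨d', hd', h'⟩ := t.exists_dart_fst_eq_snd hcl hd
      have h1 := hmem d hd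
      have h2 := hmem d' hd'
      simp only [List.map_cons, List.map_nil, List.mem_singleton] at h1 h2
      exact hloop d hd (h1.trans (h2.symm.trans h'))
    · unfold Trail.edges
      rw [← hflat]
      clear * -
      induction S with
      | nil => rfl
      | cons s S ih => simp [ih]
    · rintro i j hi hj (rfl | ⟨hi', rfl⟩)
      · exact List.isChain_iff_getElem.1 hch i (by omega)
      · obtain rfl : i = S.length - 1 := by omega
        rw [hlast'.1, hhead'.1, hcl]
    · rintro i hi rfl
      exact hhead'.2
    · rintro hk2 i hi hi'
      obtain rfl : i = S.length - 1 := by omega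
      obtain ⟨l', d, hld⟩ := List.eq_nil_or_concat' t.darts |>.resolve_left t.ne_nil
      refine hlast'.2 l' d hld ?_
      -- By disjointness `t` makes all `2 * k` visits to the tail of its last arc. Half of them are
      -- departures, so for `k ≥ 2` one departure precedes the last arc, which therefore prolongs a
      -- piece.
      have hv : t.visits d.1 = 2 * k := by
        rw [← hG d.1, ← hL.1.sum_visits d.1]
        obtain ⟨R, hR⟩ := exists_perm_cons_of_mem ht
        rw [(hR.map _).sum_eq, List.map_cons, List.sum_cons]
        simp only [Nat.left_eq_add, List.sum_eq_zero_iff, List.mem_map]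
        rintro _ ⟨t', ht', rfl⟩
        have hp := (hR.pairwise_iff (by
          intro a b hab d₁ h₁ d₂ h₂ he
          exact hab d₂ h₂ d₁ h₁ he.symm)).1 hdisj
        have hne' := (List.pairwise_cons.1 hp).1 t' ht' d (by simp [hld])
        have ht'L : t' ∈ L := hR.mem_iff.2 (by simp [ht'])
        simp only [Trail.visits, Nat.add_eq_zero_iff, List.countP_eq_zero, decide_eq_true_eq]
        refine ⟨fun e he heq => ?_, fun e he heq => hne' e he heq.symm⟩
        obtain ⟨e', he', h'⟩ := t'.exists_dart_fst_eq_snd (hL.closed_of_even heven ht'L) he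
        exact hne' e' he' (h'.trans heq).symm
      have hc := t.chain.countP_add d.1
      rw [hcl] at hc
      have hcount : 2 ≤ t.darts.countP (fun e => e.1 = d.1) := by
        unfold Trail.visits at hv
        omega
      rw [hld, List.countP_append, List.countP_singleton] at hcount
      have : 0 < l'.countP (fun e => e.1 = d.1) := by
        simp only [decide_true, if_true] at hcount
        omega
      simpa using List.countP_pos_iff.1 this
  choose seg hseg using hcut
  let p : Trail V → Bool := fun t => decide (Odd (seg t).length)
  let Lo := L.filter p
  let Le := L.filter fun t => !p t
  have hperm : (Lo ++ Le).Perm L := List.filter_append_perm p L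
  generalize hL'def : Lo ++ Le = L' at hperm
  have hmemL (c : Fin L'.length) : L'[c] ∈ L := hperm.mem_iff.1 (List.getElem_mem _)
  have hs (c : Fin L'.length) := hseg L'[c] (hmemL c)
  have hdisj' := (hperm.pairwise_iff (by
    intro a b hab d₁ h₁ d₂ h₂ he
    exact hab d₂ h₂ d₁ h₁ he.symm)).2 hdisj
  have hcne {c c' : Fin L'.length} {d d' : V × V} (hd : d ∈ L'[c].darts) (hd' : d' ∈ L'[c'].darts)
      (he : d.1 = d'.1) : c = c' := by
    rcases lt_trichotomy c c' with h | h | h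
    · exact absurd he (List.pairwise_iff_getElem.1 hdisj' c c' c.2 c'.2 h d hd d' hd')
    · exact h
    · exact absurd he.symm (List.pairwise_iff_getElem.1 hdisj' c' c c'.2 c.2 h d' hd' d hd)
  refine ⟨L'.length, Lo.length, fun c => (seg L'[c]).length, fun t => (seg L'[t.1])[t.2], ?_,
    fun c => (hs c).1, fun c => ?_, ?_, ⟨?_, ?_⟩, fun c i j => ?_, fun c i => ?_, fun h2 c i => ?_⟩
  · rw [← hL'def, List.length_append]
    omega
  · constructor
    · intro hc
      have : L'[c] ∈ Lo := by
        simp only [← hL'def, Fin.getElem_fin]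
        rw [List.getElem_append_left hc]
        exact List.getElem_mem _
      simpa [p] using (List.mem_filter.1 this).2
    · intro hodd
      by_contra hc
      have : L'[c] ∈ Le := by
        simp only [← hL'def, Fin.getElem_fin]
        rw [List.getElem_append_right (by omega)]
        exact List.getElem_mem _
      have := (List.mem_filter.1 this).2
      simp only [p, Bool.not_eq_true', decide_eq_false_iff_not] at this
      exact this hodd
  · rw [Fintype.sum_sigma, ← hL.1, ← (hperm.map _).sum_eq, ← sum_getElem]
    refine Finset.sum_congr rfl fun c _ => ?_
    rw [← (hs c).2.1, ← sum_getElem]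
  · rintro ⟨c, i⟩ ⟨c', i'⟩ he
    simp only at he
    obtain ⟨d, hd, h1⟩ := (hs c).2.2.2.2.1 _ (List.getElem_mem i.2)
    obtain ⟨d', hd', h1'⟩ := (hs c').2.2.2.2.1 _ (List.getElem_mem i'.2)
    obtain rfl : c = c' := hcne hd hd' (h1.trans (he.trans h1'.symm))
    congr 1
    ext
    have hnd := List.nodup_iff_injective_getElem.1 (hs c).2.2.1
    have := @hnd ⟨i, by simp⟩ ⟨i', by simp⟩ (by simpa using he)
    simpa using this
  · intro v
    obtain ⟨t, ht, hv⟩ : ∃ t ∈ L, t.visits v ≠ 0 := by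
      by_contra! h0
      have := hL.1.sum_visits v
      rw [List.sum_eq_zero (by simpa using h0), hG v] at this
      omega
    obtain ⟨d, hd, hdv⟩ : ∃ d ∈ t.darts, d.1 = v := by
      unfold Trail.visits at hv
      by_cases h0 : t.darts.countP (fun d => d.1 = v) = 0
      · have : 0 < t.darts.countP (fun d => d.2 = v) := by omega
        obtain ⟨d, hd, h'⟩ := List.countP_pos_iff.1 this
        obtain ⟨d', hd', h''⟩ := t.exists_dart_fst_eq_snd (hL.closed_of_even heven ht) hd
        exact ⟨d', hd', h''.trans (by simpa using h')⟩
      · simpa using List.countP_pos_iff.1 (Nat.pos_of_ne_zero h0)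
    obtain ⟨c, hc, rfl⟩ := List.getElem_of_mem (hperm.mem_iff.2 ht)
    obtain ⟨i, hi, h'⟩ := List.getElem_of_mem ((hs ⟨c, hc⟩).2.2.2.1 d hd)
    refine ⟨⟨⟨c, hc⟩, ⟨i, by simpa using hi⟩⟩, ?_⟩
    rw [← hdv, ← h']
    simp
  · exact (hs c).2.2.2.2.2.1 i j i.2 j.2
  · exact (hs c).2.2.2.2.2.2.1 i i.2
  · exact (hs c).2.2.2.2.2.2.2 h2 i i.2

end Cut

/-! ### Contributions at the junctions of a cycle -/

section Cyclic

/-- The cyclic predecessor of `i` in `Fin n`. -/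
def cyclicPred {n : ℕ} (i : Fin n) : Fin n :=
  ⟨if i.val = 0 then n - 1 else i.val - 1, by have := i.2; split_ifs <;> omega⟩

/-- The cyclic successor of `i` in `Fin n`. -/
def cyclicSucc {n : ℕ} (i : Fin n) : Fin n :=
  ⟨if i.val + 1 = n then 0 else i.val + 1, by have := i.2; split_ifs <;> omega⟩

theorem cyclicSucc_eq_iff {n : ℕ} (i j : Fin n) : cyclicSucc i = j ↔ i = cyclicPred j := by
  have hi := i.2
  have hj := j.2
  simp only [Fin.ext_iff, cyclicSucc, cyclicPred]
  split_ifs <;> omega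

variable {V : Type*} [Fintype V] [DecidableEq V]

/-- Only the piece starting at the junction and its cyclic predecessor survive in the sum. The
functions `f` and `g` are the contributions of a piece at its target and its source, before any
reversal. -/
theorem sum_ends_cyclic {N : ℕ} {n : Fin N → ℕ} (T : (Σ c, Fin (n c)) → Trail V)
    (hinj : Function.Injective fun t => (T t).src)
    (hT : ∀ c (i j : Fin (n c)), (j.val = i.val + 1 ∨ i.val + 1 = n c ∧ j.val = 0) →
        (T ⟨c, i⟩).tgt = (T ⟨c, j⟩).src) (f g : (Σ c, Fin (n c)) → ℤ) (c : Fin N)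
    (i : Fin (n c)) :
    ∑ t, ((if (T t).tgt = (T ⟨c, i⟩).src then f t else 0) +
      if (T t).src = (T ⟨c, i⟩).src then g t else 0) = f ⟨c, cyclicPred i⟩ + g ⟨c, i⟩ := by
  have hsucc (t : Σ c, Fin (n c)) : (T t).tgt = (T ⟨t.1, cyclicSucc t.2⟩).src := by
    refine hT t.1 t.2 _ ?_
    have := t.2.2
    simp only [cyclicSucc]
    split_ifs <;> omega
  have h1 (t : Σ c, Fin (n c)) : (T t).tgt = (T ⟨c, i⟩).src ↔ t = ⟨c, cyclicPred i⟩ := by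
    rw [hsucc, hinj.eq_iff]
    obtain ⟨c', j⟩ := t
    constructor
    · intro h
      obtain ⟨rfl, h⟩ := Sigma.mk.inj_iff.1 h
      exact congrArg (Sigma.mk c') ((cyclicSucc_eq_iff j i).1 (eq_of_heq h))
    · intro h
      obtain ⟨rfl, h⟩ := Sigma.mk.inj_iff.1 h
      exact congrArg (Sigma.mk c') ((cyclicSucc_eq_iff j i).2 (eq_of_heq h))
  have h2 (t : Σ c, Fin (n c)) : (T t).src = (T ⟨c, i⟩).src ↔ t = ⟨c, i⟩ := hinj.eq_iff
  simp only [h1, h2, Finset.sum_add_distrib, Finset.sum_ite_eq', mem_univ, if_true]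

end Cyclic

/-! ### The order in which the pieces are labelled -/

section TrailOrder

/-- The sort key of the trail number `i` of the cycle number `c`, which consists of `n` trails:
trails near the ends come first, and cycles with `c < r` are treated simultaneously. -/
def trailKey (r n c i : ℕ) : ℕ ×ₗ ℕ ×ₗ ℕ ×ₗ ℕ :=
  if c < r then
    if min i (n - 1 - i) = 0 then toLex (0, toLex (0, toLex (if n ≤ 2 * i then 1 else 0, c)))
    else toLex (0, toLex (min i (n - 1 - i), toLex (c, if n ≤ 2 * i then 1 else 0)))
  else toLex (c + 1, toLex (min i (n - 1 - i), toLex (if n ≤ 2 * i then 1 else 0, 0)))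

theorem toLex_quadruple_lt (a b c d a' b' c' d' : ℕ) :
    (toLex (a, toLex (b, toLex (c, d))) : ℕ ×ₗ ℕ ×ₗ ℕ ×ₗ ℕ) <
        toLex (a', toLex (b', toLex (c', d'))) ↔
      a < a' ∨ a = a' ∧ (b < b' ∨ b = b' ∧ (c < c' ∨ c = c' ∧ d < d')) := by
  simp [Prod.Lex.toLex_lt_toLex]

theorem toLex_quadruple_inj (a b c d a' b' c' d' : ℕ) :
    (toLex (a, toLex (b, toLex (c, d))) : ℕ ×ₗ ℕ ×ₗ ℕ ×ₗ ℕ) =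
        toLex (a', toLex (b', toLex (c', d'))) ↔
      a = a' ∧ b = b' ∧ c = c' ∧ d = d' := by
  simp

theorem trailKey_of_lt_of_pos {r n c i : ℕ} (hc : c < r) (hi : 0 < i) (hi' : i + 1 < n) :
    trailKey r n c i =
      toLex (0, toLex (min i (n - 1 - i), toLex (c, if n ≤ 2 * i then 1 else 0))) := by
  rw [trailKey, if_pos hc, if_neg (by omega)]

theorem trailKey_first {r n c : ℕ} (hc : c < r) (hn : 2 ≤ n) :
    trailKey r n c 0 = toLex (0, toLex (0, toLex (0, c))) := by
  rw [trailKey, if_pos hc, if_pos (by omega), if_neg (by omega)]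

theorem trailKey_last {r n c : ℕ} (hc : c < r) (hn : 2 ≤ n) :
    trailKey r n c (n - 1) = toLex (0, toLex (0, toLex (1, c))) := by
  rw [trailKey, if_pos hc, if_pos (by omega), if_pos (by omega)]

theorem trailKey_of_le {r n c i : ℕ} (hc : r ≤ c) : trailKey r n c i =
    toLex (c + 1, toLex (min i (n - 1 - i), toLex (if n ≤ 2 * i then 1 else 0, 0))) := by
  rw [trailKey, if_neg (by omega)]

theorem trailKey_injective {r n n' c c' i i' : ℕ} (hi : i < n) (hi' : i' < n')
    (hn : c = c' → n = n') (h : trailKey r n c i = trailKey r n' c' i') : c = c' ∧ i = i' := by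
  have key : c = c' → (n ≤ 2 * i ↔ n' ≤ 2 * i') → min i (n - 1 - i) = min i' (n' - 1 - i') →
      c = c' ∧ i = i' := by
    intro h1 h2 h3
    have := hn h1
    omega
  unfold trailKey at h
  split_ifs at h <;> rw [toLex_quadruple_inj] at h <;> apply key <;> omega

/-- Of the two trails at the vertex number `i` in a cycle of `n` trails, the one sorted first. -/
def loTrail (n i : ℕ) : ℕ := if i = 0 then 0 else if 2 * i ≤ n then i - 1 else i

/-- Of the two trails at the vertex number `i` in a cycle of `n` trails, the one sorted last. -/
def hiTrail (n i : ℕ) : ℕ := if i = 0 then n - 1 else if 2 * i ≤ n then i else i - 1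

/-- Here `l` is the depth, counted from the nearer end, and `s` the side. At depth 0 the side
precedes the cycle number in the key, at greater depth it follows. Since `n` is odd, `l + 1` and `n
- 1 - l` have opposite parities, so depth and parity of `i` determine the side. -/
theorem trailKey_loTrail_of_lt {r n c i : ℕ} (hc : c < r) (hn : Odd n) (hi : 0 < i) (hi' : i < n) :
    ∃ l s, (s = 0 ∧ i = l + 1 ∨ s = 1 ∧ i + l + 1 = n) ∧
      trailKey r n c (loTrail n i) = toLex (0, toLex (l, toLex (if l = 0 then s else c,
        if l = 0 then c else s))) ∧
      ∃ s', trailKey r n c (hiTrail n i) = toLex (0, toLex (l + 1, toLex (c, s'))) := by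
  obtain ⟨h, rfl⟩ := hn
  by_cases hle : 2 * i ≤ 2 * h + 1
  · refine ⟨i - 1, 0, Or.inl ⟨rfl, by omega⟩, ?_, ?_⟩
    · rw [loTrail, if_neg (by omega), if_pos hle]
      by_cases h1 : i - 1 = 0
      · rw [h1, trailKey_first hc (by omega)]
        simp
      · rw [trailKey_of_lt_of_pos hc (by omega) (by omega), if_neg h1, if_neg h1,
          if_neg (by omega), min_eq_left (by omega)]
    · rw [hiTrail, if_neg (by omega), if_pos hle, trailKey_of_lt_of_pos hc hi (by omega)]
      exact ⟨_, by rw [min_eq_left (by omega), Nat.sub_add_cancel hi]⟩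
  · refine ⟨2 * h - i, 1, Or.inr ⟨rfl, by omega⟩, ?_, ?_⟩
    · rw [loTrail, if_neg (by omega), if_neg hle]
      by_cases h1 : 2 * h - i = 0
      · rw [h1, show i = 2 * h + 1 - 1 by omega, trailKey_last hc (by omega)]
        simp
      · rw [trailKey_of_lt_of_pos hc (by omega) (by omega), if_neg h1, if_neg h1,
          if_pos (by omega), min_eq_right (by omega)]
        rfl
    · rw [hiTrail, if_neg (by omega), if_neg hle, trailKey_of_lt_of_pos hc (by omega) (by omega)]
      exact ⟨_, by rw [min_eq_right (by omega),
        show 2 * h + 1 - 1 - (i - 1) = 2 * h - i + 1 by omega]⟩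

/-- At the two extreme vertices `0` and `n / 2` both pieces have the same depth and opposite sides;
elsewhere they lie on one side at consecutive depths. -/
theorem trailKey_loTrail_of_le {r n c i : ℕ} (hc : r ≤ c) (hn : Even n) (hi' : i < n) :
    ∃ l s l₂ s₂, (i = 0 ∧ l = 0 ∧ s = 0 ∧ l₂ = 0 ∧ s₂ = 1 ∨
        0 < i ∧ 2 * i < n ∧ l + 1 = i ∧ s = 0 ∧ l₂ = i ∧ s₂ = 0 ∨
        2 * i = n ∧ l + 1 = i ∧ s = 0 ∧ l₂ + 1 = i ∧ s₂ = 1 ∨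
        n < 2 * i ∧ i + l + 1 = n ∧ s = 1 ∧ l₂ + i = n ∧ s₂ = 1) ∧
      trailKey r n c (loTrail n i) = toLex (c + 1, toLex (l, toLex (s, 0))) ∧
      trailKey r n c (hiTrail n i) = toLex (c + 1, toLex (l₂, toLex (s₂, 0))) := by
  refine ⟨_, _, _, _, ?_, trailKey_of_le hc, trailKey_of_le hc⟩
  obtain ⟨m, rfl⟩ := hn
  rcases Nat.eq_zero_or_pos i with rfl | hpos
  · simp only [loTrail, hiTrail, if_true]
    rw [if_neg (by omega), if_pos (by omega)]
    exact Or.inl ⟨trivial, by omega, rfl, by omega, rfl⟩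
  · simp only [loTrail, hiTrail, if_neg hpos.ne']
    rcases lt_trichotomy (2 * i) (m + m) with h | h | h
    · rw [if_pos h.le, if_pos h.le, if_neg (by omega), if_neg (by omega)]
      omega
    · rw [if_pos h.le, if_pos h.le, if_neg (by omega), if_pos (by omega)]
      omega
    · have h₁ : ¬ 2 * i ≤ m + m := by omega
      rw [if_neg h₁, if_neg h₁, if_pos (by omega), if_pos (by omega)]
      omega

/-- Two vertices on the same side are comparable: both trails at one of them come before the
respective trails at the other one. -/
theorem trailKey_comparable {r n n' c c' i i' : ℕ} (hn : c = c' → n = n')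
    (hc : c < r ↔ Odd n) (hc' : c' < r ↔ Odd n') (hi : i < n) (hi' : i' < n')
    (h0 : c < r → 0 < i) (h0' : c' < r → 0 < i') (hpar : i % 2 = i' % 2)
    (hne : ¬ (c = c' ∧ i = i')) :
    trailKey r n c (loTrail n i) < trailKey r n' c' (loTrail n' i') ∧
      trailKey r n c (hiTrail n i) < trailKey r n' c' (hiTrail n' i') ∨
    trailKey r n' c' (loTrail n' i') < trailKey r n c (loTrail n i) ∧
      trailKey r n' c' (hiTrail n' i') < trailKey r n c (hiTrail n i) := by
  by_cases h1 : c < r <;> by_cases h2 : c' < r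
  · obtain ⟨l, s, hl, hlo, t, hhi⟩ := trailKey_loTrail_of_lt h1 (hc.1 h1) (h0 h1) hi
    obtain ⟨l', s', hl', hlo', t', hhi'⟩ := trailKey_loTrail_of_lt h2 (hc'.1 h2) (h0' h2) hi'
    obtain ⟨h, hh⟩ := hc.1 h1
    obtain ⟨h', hh'⟩ := hc'.1 h2
    rw [hlo, hhi, hlo', hhi']
    simp only [toLex_quadruple_lt, lt_self_iff_false, false_or, true_and]
    split_ifs <;> omega
  · obtain ⟨l, s, hl, hlo, t, hhi⟩ := trailKey_loTrail_of_lt h1 (hc.1 h1) (h0 h1) hi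
    rw [hlo, hhi, trailKey_of_le (by omega), trailKey_of_le (by omega)]
    simp only [toLex_quadruple_lt]
    omega
  · obtain ⟨l', s', hl', hlo', t', hhi'⟩ := trailKey_loTrail_of_lt h2 (hc'.1 h2) (h0' h2) hi'
    rw [hlo', hhi', trailKey_of_le (by omega), trailKey_of_le (by omega)]
    simp only [toLex_quadruple_lt]
    omega
  · obtain ⟨l, s, l₂, s₂, h, hlo, hhi⟩ :=
      trailKey_loTrail_of_le (not_lt.1 h1) (Nat.not_odd_iff_even.1 (mt hc.2 h1)) hi
    obtain ⟨l', s', l₂', s₂', h', hlo', hhi'⟩ :=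
      trailKey_loTrail_of_le (not_lt.1 h2) (Nat.not_odd_iff_even.1 (mt hc'.2 h2)) hi'
    rw [hlo, hhi, hlo', hhi']
    simp only [toLex_quadruple_lt, lt_self_iff_false, and_false, or_false]
    rcases Nat.lt_trichotomy c c' with hcc | hcc | hcc
    · exact Or.inl ⟨Or.inl (by omega), Or.inl (by omega)⟩
    · obtain rfl := hn hcc
      subst hcc
      simp only [lt_self_iff_false, false_or, true_and]
      omega
    · exact Or.inr ⟨Or.inl (by omega), Or.inl (by omega)⟩

/-- This keeps the differences at the exceptional vertices below the ordinary positive sums. -/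
theorem trailKey_last_lt_hiTrail {r n n' c c' i : ℕ} (hc : c < r) (hn : 2 ≤ n)
    (hc' : c' < r ↔ Odd n') (hi : 0 < i) (hi' : i < n') :
    trailKey r n c (n - 1) < trailKey r n' c' (hiTrail n' i) := by
  rw [trailKey_last hc hn]
  by_cases h : c' < r
  · obtain ⟨l, s, -, -, t, hhi⟩ := trailKey_loTrail_of_lt h (hc'.1 h) hi hi'
    rw [hhi, toLex_quadruple_lt]
    omega
  · rw [trailKey_of_le (by omega), toLex_quadruple_lt]
    omega

end TrailOrder

/-! ### Even degree at least four -/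

section EvenDegree

variable {V : Type*} [Fintype V] [DecidableEq V] {G : SimpleGraph V} [DecidableRel G.Adj]

/-- The labels of `t` follow `p t`. The upper bound on `p t'` says that no labels intervene when no
key lies strictly between those of `t` and `t'`. -/
theorem exists_orientation_of_trails_of_key {ι κ : Type*} [Fintype ι] [LinearOrder κ] (key : ι → κ)
    (hkey : Function.Injective key) (T : ι → Trail V)
    (hT : ∑ t, (T t).edges = G.edgeFinset.val) :
    ∃ (D : Digraph V) (label : V × V → ℕ) (p : ι → ℕ), D.IsOrientationOf G ∧
      Set.BijOn label D.arcs (Set.Icc 1 D.arcs.ncard) ∧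
      (∀ t t', key t < key t' → p t + (T t).darts.length ≤ p t') ∧
      (∀ t t', (∀ x, key x < key t' → key x ≤ key t) → p t' ≤ p t + (T t).darts.length) ∧
      ∀ v, 2 * D.vertexSum label v + G.degree v =
        ∑ t, ((if (T t).tgt = v then 2 * ((p t + (T t).darts.length : ℕ) : ℤ) + 1
            else 0) - if (T t).src = v then 2 * (p t : ℤ) + 1 else 0) := by
  let _ : LinearOrder ι := LinearOrder.lift' key hkey
  obtain ⟨D, label, hD, hl, hs⟩ := exists_orientation_of_trails T hT
  refine ⟨D, label, Trail.offset T, hD, hl, fun t t' h => Trail.offset_add_length_le T h,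
    fun t t' h => ?_, hs⟩
  rw [Trail.offset_add_length]
  exact Finset.sum_le_sum_of_subset fun x hx => by
    simp only [Finset.mem_filter, mem_univ, true_and] at hx ⊢
    exact h x hx

/-- Twice the vertex sum of the vertex number `i` in a cycle of `n` trails, up to a constant, when
the trails with even number are directed forwards and those with odd number backwards; the labels
of the trail number `i` are `p i + 1, …, q i`. -/
def alternatingSum (n : ℕ) (p q : ℕ → ℕ) (i : ℕ) : ℤ :=
  (if (if i = 0 then n - 1 else i - 1) % 2 = 1 then -(2 * (p (if i = 0 then n - 1 else i - 1) : ℤ) + 1)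
    else 2 * (q (if i = 0 then n - 1 else i - 1) : ℤ) + 1) +
  if i % 2 = 1 then 2 * (q i : ℤ) + 1 else -(2 * (p i : ℤ) + 1)

/-- Piece `i - 1` runs forwards and piece `i` backwards, so both end at vertex `i`. -/
theorem alternatingSum_of_odd {n i : ℕ} (p q : ℕ → ℕ) (hi : i % 2 = 1) :
    alternatingSum n p q i = 2 * q (loTrail n i) + 2 * q (hiTrail n i) + 2 := by
  have h0 : i ≠ 0 := by omega
  have h1 : ¬ (i - 1) % 2 = 1 := by omega
  unfold alternatingSum loTrail hiTrail
  simp only [if_neg h0, if_pos hi, if_neg h1]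
  split_ifs <;> ring

/-- Both pieces start at vertex `i`; for `i = 0` this needs the last piece to have an odd number,
hence `n` even. -/
theorem alternatingSum_of_even {n i : ℕ} (p q : ℕ → ℕ) (hn : 2 ≤ n) (hi : i % 2 = 0)
    (h : Odd n → 0 < i) :
    alternatingSum n p q i = -(2 * p (loTrail n i) + 2 * p (hiTrail n i) + 2) := by
  have hi' : ¬ i % 2 = 1 := by omega
  unfold alternatingSum loTrail hiTrail
  by_cases h0 : i = 0
  · have hodd : (n - 1) % 2 = 1 := by
      have : ¬ Odd n := fun hn => by have := h hn; omega
      rw [Nat.odd_iff] at this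
      omega
    subst h0
    simp only [if_true, if_pos hodd, if_neg hi']
    ring
  · have h1 : (i - 1) % 2 = 1 := by omega
    simp only [if_neg h0, if_pos h1, if_neg hi']
    split_ifs <;> ring

/-- Pieces `n - 1` and `0` both run forwards, so one enters the vertex and the other leaves it. -/
theorem alternatingSum_zero_of_odd {n : ℕ} (p q : ℕ → ℕ) (hn : Odd n) :
    alternatingSum n p q 0 = 2 * q (n - 1) - 2 * p 0 := by
  have h1 : ¬ (n - 1) % 2 = 1 := by
    rw [Nat.odd_iff] at hn
    omega
  unfold alternatingSum
  simp only [if_true, if_neg h1, Nat.zero_mod, zero_ne_one, if_false]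
  ring

theorem loTrail_lt {n i : ℕ} (hi : i < n) : loTrail n i < n := by
  unfold loTrail
  split_ifs <;> omega

theorem hiTrail_lt {n i : ℕ} (hi : i < n) : hiTrail n i < n := by
  unfold hiTrail
  split_ifs <;> omega

/-- Ordinary vertices with even number have negative sums, those with odd number positive ones, and
within a sign comparability decides. The exceptional sums are positive, increase with the cycle by
`hfirst`, and stay below `2 * q` of the later piece at any odd-numbered vertex. -/
theorem alternatingSum_injective {N r : ℕ} {n : Fin N → ℕ} (h2 : ∀ c, 2 ≤ n c)
    (hr : ∀ c, c.val < r ↔ Odd (n c)) {p q : Fin N → ℕ → ℕ}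
    (hpq : ∀ c i, i < n c → p c i < q c i)
    (hmono : ∀ c c' i i', i < n c → i' < n c' →
      trailKey r (n c) c i < trailKey r (n c') c' i' → q c i ≤ p c' i')
    (hfirst : ∀ c c' : Fin N, c < c' → c'.val < r →
      q c (n c - 1) + p c' 0 < q c' (n c' - 1) + p c 0)
    {c c' : Fin N} {i i' : ℕ} (hi : i < n c) (hi' : i' < n c')
    (h : alternatingSum (n c) (p c) (q c) i = alternatingSum (n c') (p c') (q c') i') :
    c = c' ∧ i = i' := by
  have hD (c : Fin N) (hc : c.val < r) : 0 < alternatingSum (n c) (p c) (q c) 0 := by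
    rw [alternatingSum_zero_of_odd _ _ ((hr c).1 hc)]
    have h1 := hmono c c 0 (n c - 1) (by have := h2 c; omega) (by have := h2 c; omega) (by
      rw [trailKey_first hc (h2 c), trailKey_last hc (h2 c), toLex_quadruple_lt]
      omega)
    have h3 := hpq c 0 (by have := h2 c; omega)
    have h4 := hpq c (n c - 1) (by have := h2 c; omega)
    omega
  have hDB (c c' : Fin N) (i : ℕ) (hc : c.val < r) (hi : i < n c') (hodd : i % 2 = 1) :
      alternatingSum (n c) (p c) (q c) 0 < alternatingSum (n c') (p c') (q c') i := by
    rw [alternatingSum_zero_of_odd _ _ ((hr c).1 hc), alternatingSum_of_odd _ _ hodd]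
    have h1 := hmono c c' (n c - 1) (hiTrail (n c') i) (by have := h2 c; omega) (hiTrail_lt hi)
      (trailKey_last_lt_hiTrail hc (h2 c) (hr c') (by omega) hi)
    have h3 := hpq c' _ (hiTrail_lt hi)
    omega
  have hDD (c c' : Fin N) (hc : c.val < r) (hc' : c'.val < r) (hlt : c < c') :
      alternatingSum (n c) (p c) (q c) 0 < alternatingSum (n c') (p c') (q c') 0 := by
    rw [alternatingSum_zero_of_odd _ _ ((hr c).1 hc), alternatingSum_zero_of_odd _ _ ((hr c').1 hc')]
    have := hfirst c c' hlt hc'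
    omega
  by_contra hne
  have hne' : ¬ (c.val = c'.val ∧ i = i') := by simpa [Fin.ext_iff] using hne
  have hcomp (h0 : c.val < r → 0 < i) (h0' : c'.val < r → 0 < i') (hpar : i % 2 = i' % 2) :=
    trailKey_comparable (r := r) (n := n c) (n' := n c') (c := c) (c' := c') (i := i) (i' := i')
      (fun h => by rw [Fin.ext h]) (hr c) (hr c') hi hi' h0 h0' hpar hne'
  have hlo := loTrail_lt hi
  have hlo' := loTrail_lt hi'
  have hhi := hiTrail_lt hi
  have hhi' := hiTrail_lt hi'
  have e1 := hpq c _ hlo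
  have e2 := hpq c _ hhi
  have e3 := hpq c' _ hlo'
  have e4 := hpq c' _ hhi'
  have hcomp' (h0 : c.val < r → 0 < i) (h0' : c'.val < r → 0 < i') (hpar : i % 2 = i' % 2) :
      q c (loTrail (n c) i) ≤ p c' (loTrail (n c') i') ∧
        q c (hiTrail (n c) i) ≤ p c' (hiTrail (n c') i') ∨
      q c' (loTrail (n c') i') ≤ p c (loTrail (n c) i) ∧
        q c' (hiTrail (n c') i') ≤ p c (hiTrail (n c) i) := by
    rcases hcomp h0 h0' hpar with h | h
    · exact Or.inl ⟨hmono _ _ _ _ hlo hlo' h.1, hmono _ _ _ _ hhi hhi' h.2⟩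
    · exact Or.inr ⟨hmono _ _ _ _ hlo' hlo h.1, hmono _ _ _ _ hhi' hhi h.2⟩
  rcases Nat.mod_two_eq_zero_or_one i with hp | hp <;>
    rcases Nat.mod_two_eq_zero_or_one i' with hp' | hp'
  · by_cases h0 : c.val < r ∧ i = 0 <;> by_cases h0' : c'.val < r ∧ i' = 0
    · obtain ⟨hc, rfl⟩ := h0
      obtain ⟨hc', rfl⟩ := h0'
      rcases lt_trichotomy c c' with hlt | heq | hlt
      · exact (hDD c c' hc hc' hlt).ne h
      · exact hne ⟨heq, rfl⟩
      · exact (hDD c' c hc' hc hlt).ne' h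
    · obtain ⟨hc, rfl⟩ := h0
      have := hD c hc
      rw [h, alternatingSum_of_even _ _ (h2 c') hp'
        (fun ho => by have := (hr c').2 ho; omega)] at this
      omega
    · obtain ⟨hc', rfl⟩ := h0'
      have := hD c' hc'
      rw [← h, alternatingSum_of_even _ _ (h2 c) hp
        (fun ho => by have := (hr c).2 ho; omega)] at this
      omega
    · rw [alternatingSum_of_even _ _ (h2 c) hp (fun ho => by have := (hr c).2 ho; omega),
        alternatingSum_of_even _ _ (h2 c') hp' (fun ho => by have := (hr c').2 ho; omega)] at h
      have := hcomp' (by omega) (by omega) (by omega)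
      omega
  · by_cases h0 : c.val < r ∧ i = 0
    · obtain ⟨hc, rfl⟩ := h0
      exact (hDB c c' i' hc hi' hp').ne h
    · rw [alternatingSum_of_even _ _ (h2 c) hp (fun ho => by have := (hr c).2 ho; omega),
        alternatingSum_of_odd _ _ hp'] at h
      omega
  · by_cases h0 : c'.val < r ∧ i' = 0
    · obtain ⟨hc, rfl⟩ := h0
      exact (hDB c' c i hc hi hp).ne' h
    · rw [alternatingSum_of_even _ _ (h2 c') hp' (fun ho => by have := (hr c').2 ho; omega),
        alternatingSum_of_odd _ _ hp] at h
      omega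
  · rw [alternatingSum_of_odd _ _ hp, alternatingSum_of_odd _ _ hp'] at h
    have := hcomp' (by omega) (by omega) (by omega)
    omega

theorem hasAntimagicOrientation_of_even {k : ℕ} (hk : 2 ≤ k) (hG : G.IsRegularOfDegree (2 * k)) :
    G.HasAntimagicOrientation := by
  obtain ⟨N, r, n, T, hrN, h2, hr, hT, hbij, hcyc, hone, htwo⟩ :=
    exists_cyclic_trails (by omega) hG
  let key : (Σ c, Fin (n c)) → ℕ ×ₗ ℕ ×ₗ ℕ ×ₗ ℕ := fun t => trailKey r (n t.1) t.1 t.2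
  have hkey : Function.Injective key := by
    rintro ⟨c, i⟩ ⟨c', i'⟩ h
    obtain ⟨h1, h3⟩ := trailKey_injective i.2 i'.2 (fun h => congrArg n (Fin.ext h)) h
    obtain rfl : c = c' := Fin.ext h1
    obtain rfl : i = i' := Fin.ext h3
    rfl
  let T' : (Σ c, Fin (n c)) → Trail V := fun t =>
    if t.2.val % 2 = 1 then (T t).reverse else T t
  have hlen (t) : (T' t).darts.length = (T t).darts.length := by
    simp only [T']
    split_ifs <;> simp [Trail.reverse]
  have hT' : ∑ t, (T' t).edges = G.edgeFinset.val := by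
    rw [← hT]
    refine Finset.sum_congr rfl fun t _ => ?_
    simp only [T']
    split_ifs
    · exact Trail.edges_reverse _
    · rfl
  obtain ⟨D, label, p, hD, hl, hlt, hcov, hs⟩ := exists_orientation_of_trails_of_key key hkey T' hT'
  simp only [hlen] at hlt hcov hs
  let q : (Σ c, Fin (n c)) → ℕ := fun t => p t + (T t).darts.length
  let P : Fin N → ℕ → ℕ := fun c i => if h : i < n c then p ⟨c, i, h⟩ else 0
  let Q : Fin N → ℕ → ℕ := fun c i => if h : i < n c then q ⟨c, i, h⟩ else 0
  have hP (c : Fin N) (i : Fin (n c)) : P c i = p ⟨c, i⟩ := by simp [P]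
  have hQ (c : Fin N) (i : Fin (n c)) : Q c i = q ⟨c, i⟩ := by simp [Q]
  have hval (c : Fin N) (i : Fin (n c)) :
      2 * D.vertexSum label (T ⟨c, i⟩).src + (2 * k : ℕ) =
        alternatingSum (n c) (P c) (Q c) i := by
    have h := hs (T ⟨c, i⟩).src
    rw [hG] at h
    rw [h]
    have hsum := sum_ends_cyclic T hbij.1 hcyc
      (fun t => if t.2.val % 2 = 1 then -(2 * (p t : ℤ) + 1) else 2 * (q t : ℤ) + 1)
      (fun t => if t.2.val % 2 = 1 then 2 * (q t : ℤ) + 1 else -(2 * (p t : ℤ) + 1)) c i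
    convert hsum using 1
    · refine Finset.sum_congr rfl fun t _ => ?_
      simp only [T', q]
      by_cases ho : t.2.val % 2 = 1
      · simp only [ho, if_true, Trail.reverse]
        split_ifs <;> ring
      · simp only [ho, if_false]
        split_ifs <;> ring
    · unfold alternatingSum
      have h1 : P c (if i.val = 0 then n c - 1 else i - 1) = p ⟨c, cyclicPred i⟩ :=
        hP c (cyclicPred i)
      have h3 : Q c (if i.val = 0 then n c - 1 else i - 1) = q ⟨c, cyclicPred i⟩ :=
        hQ c (cyclicPred i)
      rw [h1, h3, hP, hQ]
      rfl
  have hfirst_lt (c : Fin N) : 0 < n c := by have := h2 c; omega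
  have hlast_lt (c : Fin N) : n c - 1 < n c := by have := h2 c; omega
  have hstep (c c' : Fin N) (hcc : c'.val = c.val + 1) (hc' : c'.val < r) :
      Q c (n c - 1) + P c' 0 < Q c' (n c' - 1) + P c 0 := by
    simp only [P, Q, q, dif_pos (hfirst_lt _), dif_pos (hlast_lt _)]
    -- From `c` to the next odd cycle, `P` of the first piece grows by at most 1, because that piece
    -- has length 1 and no key lies in between. `Q` of the last piece grows by at least 2.
    have h1 := hcov ⟨c, 0, hfirst_lt c⟩ ⟨c', 0, hfirst_lt c'⟩ (by
      rintro x hx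
      simp only [key] at hx ⊢
      rw [trailKey_first hc' (h2 c')] at hx
      rw [trailKey_first (by omega) (h2 c), ← not_lt]
      generalize trailKey r (n x.1) x.1 x.2 = y at hx ⊢
      obtain ⟨a, b, e, f⟩ := y
      intro hy
      have hx' := (toLex_quadruple_lt a b e f _ _ _ _).1 hx
      have hy' := (toLex_quadruple_lt _ _ _ _ a b e f).1 hy
      omega)
    have h3 := hlt ⟨c, n c - 1, hlast_lt c⟩ ⟨c', n c' - 1, hlast_lt c'⟩ (by
      simp only [key]
      rw [trailKey_last (by omega) (h2 c), trailKey_last hc' (h2 c'), toLex_quadruple_lt]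
      omega)
    have h4 := hone c ⟨0, hfirst_lt c⟩ rfl
    have h5 := htwo hk c' ⟨n c' - 1, hlast_lt c'⟩ (by have := h2 c'; simp only; omega)
    omega
  have hfirst : ∀ c c' : Fin N, c < c' → c'.val < r →
      Q c (n c - 1) + P c' 0 < Q c' (n c' - 1) + P c 0 := by
    intro c c' hlt hc'
    obtain ⟨m, hm⟩ := c'
    have hlt' : c.val + 1 ≤ m := hlt
    clear hlt
    induction m, hlt' using Nat.le_induction with
    | base => exact hstep c _ rfl hc'
    | succ m hcm ih =>
      have h1 := ih (by omega) (by simp only at hc' ⊢; omega)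
      have h3 := hstep ⟨m, by omega⟩ ⟨m + 1, hm⟩ rfl hc'
      omega
  refine ⟨D, hD, label, hl, fun u w huw => ?_⟩
  obtain ⟨⟨c, i⟩, rfl⟩ := hbij.2 u
  obtain ⟨⟨c', i'⟩, rfl⟩ := hbij.2 w
  simp only at huw ⊢
  have h1 := hval c i
  rw [huw, hval c' i'] at h1
  obtain ⟨rfl, hii⟩ := alternatingSum_injective h2 hr (p := P) (q := Q)
    (fun c i hi => by
      have := (T ⟨c, i, hi⟩).length_pos
      simp only [P, Q, q, dif_pos hi]
      omega)
    (fun c c' i i' hi hi' h => by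
      simp only [P, Q, q, dif_pos hi, dif_pos hi']
      exact hlt ⟨c, i, hi⟩ ⟨c', i', hi'⟩ h)
    hfirst i.2 i'.2 h1.symm
  obtain rfl : i = i' := Fin.ext hii
  rfl

end EvenDegree

/-! ### Explicit labels for disjoint cycles -/

section TwoRegular

/-- The label of the edge number `i` of the cycle number `c`, which has length `n`; the cycles with
`c < r` are the odd ones, and the labels after `off` are reserved for this cycle. -/
def cycleLabel (r n off c i : ℕ) : ℕ :=
  if c < r then
    if i = 0 then c + 1
    else if i = 1 then r + 2 * c + 1 + (r + c) % 2
    else if i + 1 = n then r + 2 * c + 2 - (r + c) % 2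
    else if (r + c) % 2 = 0 then off + i - 1 else off + n - 1 - i
  else if 2 * i < n then off + 2 * i + 1 else off + 2 * (n - i)

/-- The number of labels in the range reserved for a cycle of length `n`. -/
def reservedLabels (r n c : ℕ) : ℕ := if c < r then n - 3 else n

variable {N r : ℕ} {n off : Fin N → ℕ}

theorem cycleLabel_cases {n off c i : ℕ} (hi : i < n) :
    c < r ∧ i = 0 ∧ cycleLabel r n off c i = c + 1 ∨
    c < r ∧ i = 1 ∧ cycleLabel r n off c i = r + 2 * c + 1 + (r + c) % 2 ∨
    c < r ∧ 1 < i ∧ i + 1 = n ∧ cycleLabel r n off c i = r + 2 * c + 2 - (r + c) % 2 ∨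
    c < r ∧ 1 < i ∧ i + 1 < n ∧ (r + c) % 2 = 0 ∧ cycleLabel r n off c i = off + i - 1 ∨
    c < r ∧ 1 < i ∧ i + 1 < n ∧ (r + c) % 2 = 1 ∧ cycleLabel r n off c i = off + n - 1 - i ∨
    r ≤ c ∧ 2 * i < n ∧ cycleLabel r n off c i = off + 2 * i + 1 ∨
    r ≤ c ∧ n ≤ 2 * i ∧ cycleLabel r n off c i = off + 2 * (n - i) := by
  unfold cycleLabel
  split_ifs with hc h0 h1 hl hp he
  · exact Or.inl ⟨hc, h0, rfl⟩
  · exact Or.inr (Or.inl ⟨hc, h1, rfl⟩)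
  · exact Or.inr (Or.inr (Or.inl ⟨hc, by omega, hl, rfl⟩))
  · exact Or.inr (Or.inr (Or.inr (Or.inl ⟨hc, by omega, by omega, hp, rfl⟩)))
  · exact Or.inr (Or.inr (Or.inr (Or.inr (Or.inl ⟨hc, by omega, by omega, by omega, rfl⟩))))
  · exact Or.inr (Or.inr (Or.inr (Or.inr (Or.inr (Or.inl ⟨by omega, he, rfl⟩)))))
  · exact Or.inr (Or.inr (Or.inr (Or.inr (Or.inr (Or.inr ⟨by omega, by omega, rfl⟩)))))

/-- On odd cycles, edges `0` use the labels up to `r`, and edges `1` and `n - 1` use the pair `r + 2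
* c + 1`, `r + 2 * c + 2`, hence labels up to `3 * r`. All other labels lie in disjoint ranges
beyond. -/
theorem cycleLabel_injective (hr : ∀ c, c.val < r ↔ Odd (n c))
    (hoff : ∀ c, 3 * r ≤ off c)
    (hlt : ∀ c c' : Fin N, c < c' → off c + reservedLabels r (n c) c ≤ off c')
    {c c' : Fin N} {i i' : ℕ} (hi : i < n c) (hi' : i' < n c')
    (h : cycleLabel r (n c) (off c) c i = cycleLabel r (n c') (off c') c' i') :
    c = c' ∧ i = i' := by
  have o1 := hoff c
  have o2 := hoff c'
  have p1 : c.val < r → n c % 2 = 1 := fun h => Nat.odd_iff.1 ((hr c).1 h)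
  have p2 : c'.val < r → n c' % 2 = 1 := fun h => Nat.odd_iff.1 ((hr c').1 h)
  have q1 : r ≤ c.val → n c % 2 = 0 := fun h => by
    have := mt (hr c).2 (not_lt.2 h); rw [Nat.odd_iff] at this; omega
  have q2 : r ≤ c'.val → n c' % 2 = 0 := fun h => by
    have := mt (hr c').2 (not_lt.2 h); rw [Nat.odd_iff] at this; omega
  have H1 := cycleLabel_cases (r := r) (off := off c) (c := c) hi
  have H2 := cycleLabel_cases (r := r) (off := off c') (c := c') hi'
  rw [← h] at H2
  generalize cycleLabel r (n c) (off c) c i = x at H1 H2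
  rcases lt_trichotomy c c' with hcc | rfl | hcc
  · exfalso
    have l := hlt c c' hcc
    rw [Fin.lt_def] at hcc
    unfold reservedLabels at l
    rcases H1 with H1 | H1 | H1 | H1 | H1 | H1 | H1 <;>
      rcases H2 with H2 | H2 | H2 | H2 | H2 | H2 | H2 <;> split_ifs at l <;> omega
  · refine ⟨rfl, ?_⟩
    rcases H1 with H1 | H1 | H1 | H1 | H1 | H1 | H1 <;>
      rcases H2 with H2 | H2 | H2 | H2 | H2 | H2 | H2 <;> omega
  · exfalso
    have l := hlt c' c hcc
    rw [Fin.lt_def] at hcc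
    unfold reservedLabels at l
    rcases H1 with H1 | H1 | H1 | H1 | H1 | H1 | H1 <;>
      rcases H2 with H2 | H2 | H2 | H2 | H2 | H2 | H2 <;> split_ifs at l <;> omega

theorem cycleLabel_mem_Icc {n off c i m : ℕ} (h2 : 2 ≤ n) (hr : c < r ↔ Odd n) (hi : i < n)
    (hm : 3 * r ≤ m) (hoff : off + reservedLabels r n c ≤ m) :
    1 ≤ cycleLabel r n off c i ∧ cycleLabel r n off c i ≤ m := by
  have p : c < r → n % 2 = 1 := fun h => Nat.odd_iff.1 (hr.1 h)
  have H := cycleLabel_cases (r := r) (off := off) (c := c) hi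
  unfold reservedLabels at hoff
  generalize cycleLabel r n off c i = x at *
  rcases H with H | H | H | H | H | H | H <;> split_ifs at hoff <;> omega

/-- The sum of the two labels at the vertex number `i`, or their difference if one of the two arcs
enters and the other one leaves. -/
def absVertexSum (r n off c i : ℕ) : ℕ :=
  if i = 0 then
    if c < r then cycleLabel r n off c (n - 1) - cycleLabel r n off c 0
    else cycleLabel r n off c (n - 1) + cycleLabel r n off c 0
  else cycleLabel r n off c (i - 1) + cycleLabel r n off c i

theorem absVertexSum_cases_of_lt {n off c i : ℕ} (hc : c < r) (h2 : 2 ≤ n) (hn : n % 2 = 1)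
    (hi : i < n) :
    i = 0 ∧ absVertexSum r n off c i = r + c + 1 - (r + c) % 2 ∨
    i = 1 ∧ absVertexSum r n off c i = r + 3 * c + 2 + (r + c) % 2 ∨
    n = 3 ∧ i = 2 ∧ absVertexSum r n off c i = 2 * r + 4 * c + 3 ∨
    5 ≤ n ∧ (i = 2 ∧ (r + c) % 2 = 0 ∨ i + 1 = n ∧ (r + c) % 2 = 1) ∧
      absVertexSum r n off c i = off + r + 2 * c + 2 ∨
    5 ≤ n ∧ (i = 2 ∧ (r + c) % 2 = 1 ∨ i + 1 = n ∧ (r + c) % 2 = 0) ∧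
      absVertexSum r n off c i = off + r + 2 * c + n - 1 ∨
    3 ≤ i ∧ i + 1 < n ∧ (r + c) % 2 = 0 ∧ absVertexSum r n off c i = 2 * off + 2 * i - 3 ∨
    3 ≤ i ∧ i + 1 < n ∧ (r + c) % 2 = 1 ∧
      absVertexSum r n off c i = 2 * off + 2 * n - 2 * i - 1 := by
  have hlast : cycleLabel r n off c (n - 1) = r + 2 * c + 2 - (r + c) % 2 := by
    rw [cycleLabel, if_pos hc, if_neg (by omega), if_neg (by omega), if_pos (by omega)]
  have hzero : cycleLabel r n off c 0 = c + 1 := by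
    rw [cycleLabel, if_pos hc, if_pos rfl]
  have hone : cycleLabel r n off c 1 = r + 2 * c + 1 + (r + c) % 2 := by
    rw [cycleLabel, if_pos hc, if_neg (by omega), if_pos rfl]
  have hmid {j : ℕ} (h1 : 1 < j) (hj : j + 1 < n) : cycleLabel r n off c j =
      if (r + c) % 2 = 0 then off + j - 1 else off + n - 1 - j := by
    rw [cycleLabel, if_pos hc, if_neg (by omega), if_neg (by omega), if_neg (by omega)]
  unfold absVertexSum
  by_cases h0 : i = 0
  · simp only [if_pos h0, if_pos hc, hlast, hzero]
    left
    omega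
  simp only [if_neg h0]
  by_cases h1 : i = 1
  · subst h1
    rw [Nat.sub_self, hzero, hone]
    right; left
    omega
  by_cases h3 : i = 2
  · subst h3
    rw [show 2 - 1 = 1 from rfl, hone]
    by_cases hn3 : n = 3
    · subst hn3
      rw [show cycleLabel r 3 off c 2 = _ from hlast]
      exact Or.inr (Or.inr (Or.inl ⟨rfl, rfl, by omega⟩))
    · rw [hmid (by omega) (by omega)]
      by_cases hp : (r + c) % 2 = 0
      · rw [if_pos hp]
        exact Or.inr (Or.inr (Or.inr (Or.inl ⟨by omega, Or.inl ⟨rfl, hp⟩, by omega⟩)))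
      · rw [if_neg hp]
        exact Or.inr (Or.inr (Or.inr (Or.inr (Or.inl
          ⟨by omega, Or.inl ⟨rfl, by omega⟩, by omega⟩))))
  by_cases hl : i + 1 = n
  · obtain rfl : i = n - 1 := by omega
    rw [hmid (by omega) (by omega), hlast]
    by_cases hp : (r + c) % 2 = 0
    · rw [if_pos hp]
      exact Or.inr (Or.inr (Or.inr (Or.inr (Or.inl ⟨by omega, Or.inr ⟨hl, hp⟩, by omega⟩))))
    · rw [if_neg hp]
      exact Or.inr (Or.inr (Or.inr (Or.inl ⟨by omega, Or.inr ⟨hl, by omega⟩, by omega⟩)))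
  · rw [hmid (by omega) (by omega), hmid (by omega) (by omega)]
    by_cases hp : (r + c) % 2 = 0
    · rw [if_pos hp, if_pos hp]
      exact Or.inr (Or.inr (Or.inr (Or.inr (Or.inr (Or.inl
        ⟨by omega, by omega, hp, by omega⟩)))))
    · rw [if_neg hp, if_neg hp]
      exact Or.inr (Or.inr (Or.inr (Or.inr (Or.inr (Or.inr
        ⟨by omega, by omega, by omega, by omega⟩)))))

theorem absVertexSum_cases_of_le {n off c i : ℕ} (hc : r ≤ c) (h2 : 2 ≤ n) (hn : n % 2 = 0)
    (hi : i < n) :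
    i = 0 ∧ absVertexSum r n off c i = 2 * off + 3 ∨
    0 < i ∧ 2 * i < n ∧ absVertexSum r n off c i = 2 * off + 4 * i ∨
    2 * i = n ∧ absVertexSum r n off c i = 2 * off + 2 * n - 1 ∨
    n < 2 * i ∧ absVertexSum r n off c i = 2 * off + 4 * (n - i) + 2 := by
  have hlab (j : ℕ) : cycleLabel r n off c j =
      if 2 * j < n then off + 2 * j + 1 else off + 2 * (n - j) := by
    rw [cycleLabel, if_neg (by omega)]
  unfold absVertexSum
  simp only [hlab, if_neg (not_lt.2 hc)]
  split_ifs <;> omega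

/-- As `off` and `r` have equal parity, the values are even at vertex `1` and, for `n ≥ 5`, at
vertices `2` and `n - 1`; all others are odd. Size separates the values within each parity, except
that the odd values at vertices `0` may agree for two cycles with `r + c` and `r + c'` of different
parity. -/
theorem absVertexSum_ne_of_lt_of_lt {n n' off off' c c' i i' : ℕ} (hc' : c' < r) (hcc : c < c')
    (h2 : 2 ≤ n) (h2' : 2 ≤ n') (hn : n % 2 = 1) (hn' : n' % 2 = 1) (hoff : 3 * r ≤ off)
    (hpar : off % 2 = r % 2) (hpar' : off' % 2 = r % 2) (hlt : off + (n - 3) ≤ off')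
    (hi : i < n) (hi' : i' < n')
    (h : absVertexSum r n off c i = absVertexSum r n' off' c' i') :
    i = 0 ∧ i' = 0 ∧ (r + c) % 2 ≠ (r + c') % 2 := by
  have H1 := absVertexSum_cases_of_lt (off := off) (hcc.trans hc') h2 hn hi
  have H2 := absVertexSum_cases_of_lt (off := off') hc' h2' hn' hi'
  rw [← h] at H2
  generalize absVertexSum r n off c i = x at H1 H2
  clear h
  rcases H1 with ⟨h0, H1⟩ | H1
  · rcases H2 with ⟨h0', H2⟩ | H2
    · exact ⟨h0, h0', by omega⟩
    · exfalso
      rcases H2 with ⟨-, H2⟩ | ⟨-, -, H2⟩ | ⟨-, -, H2⟩ | ⟨-, -, H2⟩ | H2 | H2 <;> omega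
  · exfalso
    rcases H1 with ⟨-, H1⟩ | ⟨-, -, H1⟩ | ⟨-, -, H1⟩ | ⟨-, -, H1⟩ | H1 | H1 <;>
    rcases H2 with ⟨-, H2⟩ | ⟨-, H2⟩ | ⟨-, -, H2⟩ | ⟨-, -, H2⟩ | ⟨-, -, H2⟩ | H2 | H2 <;>
    omega

end TwoRegular

/-! ### Signed vertex sums on cycles; degree two -/

section TwoRegular

variable {N r : ℕ} {n off : Fin N → ℕ}

theorem absVertexSum_injective_of_lt {n off c i i' : ℕ} (hc : c < r) (h2 : 2 ≤ n)
    (hn : n % 2 = 1) (hoff : 3 * r ≤ off) (hpar : off % 2 = r % 2) (hi : i < n) (hi' : i' < n)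
    (h : absVertexSum r n off c i = absVertexSum r n off c i') : i = i' := by
  have H1 := absVertexSum_cases_of_lt (off := off) hc h2 hn hi
  have H2 := absVertexSum_cases_of_lt (off := off) hc h2 hn hi'
  rw [← h] at H2
  generalize absVertexSum r n off c i = x at H1 H2
  clear h
  rcases H1 with H1 | H1 | H1 | H1 | H1 | H1 | H1 <;>
    rcases H2 with H2 | H2 | H2 | H2 | H2 | H2 | H2 <;> omega

/-- All labels of cycle `c` are at most `off'`, whereas the smallest sum on the even cycle `c'` is
`(off' + 1) + (off' + 2)`. -/
theorem absVertexSum_lt_of_le {n n' off off' c c' i i' : ℕ} (hc' : r ≤ c')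
    (h2 : 2 ≤ n) (h2' : 2 ≤ n') (hn : c < r ↔ n % 2 = 1) (hn' : n' % 2 = 0) (hoff : 3 * r ≤ off)
    (hlt : off + reservedLabels r n c ≤ off') (hi : i < n) (hi' : i' < n') :
    absVertexSum r n off c i < absVertexSum r n' off' c' i' := by
  have h1 : 2 * off' + 3 ≤ absVertexSum r n' off' c' i' := by
    rcases absVertexSum_cases_of_le (off := off') hc' h2' hn' hi' with H | H | H | H <;> omega
  refine lt_of_lt_of_le ?_ h1
  unfold reservedLabels at hlt
  by_cases hc : c < r
  · rw [if_pos hc] at hlt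
    rcases absVertexSum_cases_of_lt (off := off) hc h2 (hn.1 hc) hi with
      H | H | H | H | H | H | H <;> omega
  · rw [if_neg hc] at hlt
    rcases absVertexSum_cases_of_le (off := off) (not_lt.1 hc) h2 (by omega) hi with
      H | H | H | H <;> omega

/-- The parity condition, which reflects equal signs, matters only for `n = 2`, where both vertices
have the value `2 * off + 3`. -/
theorem absVertexSum_injective_of_le {n off c i i' : ℕ} (hc : r ≤ c) (h2 : 2 ≤ n)
    (hn : n % 2 = 0) (hi : i < n) (hi' : i' < n) (hii : i % 2 = i' % 2)
    (h : absVertexSum r n off c i = absVertexSum r n off c i') : i = i' := by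
  have H1 := absVertexSum_cases_of_le (off := off) hc h2 hn hi
  have H2 := absVertexSum_cases_of_le (off := off) hc h2 hn hi'
  rw [← h] at H2
  generalize absVertexSum r n off c i = x at H1 H2
  clear h
  rcases H1 with H1 | H1 | H1 | H1 <;> rcases H2 with H2 | H2 | H2 | H2 <;> omega

theorem absVertexSum_pos {n off c i : ℕ} (h2 : 2 ≤ n) (hn : c < r ↔ n % 2 = 1) (hi : i < n) :
    0 < absVertexSum r n off c i := by
  by_cases hc : c < r
  · rcases absVertexSum_cases_of_lt (off := off) hc h2 (hn.1 hc) hi with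
      H | H | H | H | H | H | H <;> omega
  · rcases absVertexSum_cases_of_le (off := off) (not_lt.1 hc) h2 (by omega) hi with
      H | H | H | H <;> omega

/-- The edge number `i` of the cycle number `c` is directed backwards. -/
def IsBackward (r c i : ℕ) : Prop := (i % 2 = 1) ↔ ¬ (c < r ∧ (r + c) % 2 = 1)

instance (r c i : ℕ) : Decidable (IsBackward r c i) := by unfold IsBackward; infer_instance

/-- The vertex sum of the vertex number `i` of the cycle number `c`. -/
def cycleVertexSum (r n off c i : ℕ) : ℤ :=
  (if IsBackward r c (if i = 0 then n - 1 else i - 1) then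
      -(cycleLabel r n off c (if i = 0 then n - 1 else i - 1) : ℤ)
    else cycleLabel r n off c (if i = 0 then n - 1 else i - 1)) +
  if IsBackward r c i then (cycleLabel r n off c i : ℤ) else -cycleLabel r n off c i

/-- Directions alternate, so the two arcs at a vertex both enter or both leave it. At vertex `0` of
an odd cycle one enters and one leaves, and the larger label, that of the last edge, determines the
sign. -/
theorem cycleVertexSum_eq {n off c i : ℕ} (h2 : 2 ≤ n) (hn : c < r ↔ n % 2 = 1) :
    cycleVertexSum r n off c i =
      if (i % 2 = 1 ∨ i = 0 ∧ c < r) ↔ ¬ (c < r ∧ (r + c) % 2 = 1) then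
        (absVertexSum r n off c i : ℤ) else -absVertexSum r n off c i := by
  unfold cycleVertexSum absVertexSum
  by_cases h0 : i = 0
  · subst h0
    unfold IsBackward
    by_cases hc : c < r
    · have hle : cycleLabel r n off c 0 ≤ cycleLabel r n off c (n - 1) := by
        have hlast : cycleLabel r n off c (n - 1) = r + 2 * c + 2 - (r + c) % 2 := by
          rw [cycleLabel, if_pos hc, if_neg (by omega), if_neg (by omega), if_pos (by omega)]
        have hzero : cycleLabel r n off c 0 = c + 1 := by
          rw [cycleLabel, if_pos hc, if_pos rfl]
        omega
      have h1 : (n - 1) % 2 = 0 := by have := hn.1 hc; omega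
      by_cases hp : (r + c) % 2 = 1
      · simp [hc, h1, hp, Nat.cast_sub hle]
        ring
      · simp [hc, h1, hp, Nat.cast_sub hle]
        ring
    · have h1 : (n - 1) % 2 = 1 := by omega
      simp [hc, h1]
      ring
  · rw [if_neg h0, if_neg h0]
    by_cases hb : IsBackward r c i
    · have h1 : ¬ IsBackward r c (i - 1) := by
        unfold IsBackward at *
        omega
      rw [if_neg h1, if_pos hb, if_pos (by unfold IsBackward at hb; omega), Nat.cast_add]
    · have h1 : IsBackward r c (i - 1) := by
        unfold IsBackward at *
        omega
      rw [if_pos h1, if_neg hb, if_neg (by unfold IsBackward at hb; omega), Nat.cast_add]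
      ring

theorem cycleVertexSum_injective_of_le (h2 : ∀ c, 2 ≤ n c)
    (hn : ∀ c : Fin N, c.val < r ↔ n c % 2 = 1) (hoff : ∀ c, 3 * r ≤ off c)
    (hpar : ∀ c : Fin N, c.val < r → off c % 2 = r % 2)
    (hlt : ∀ c c' : Fin N, c < c' → off c + reservedLabels r (n c) c ≤ off c')
    {c c' : Fin N} {i i' : ℕ} (hcc : c ≤ c') (hi : i < n c) (hi' : i' < n c')
    (h : cycleVertexSum r (n c) (off c) c i = cycleVertexSum r (n c') (off c') c' i') :
    c = c' ∧ i = i' := by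
  have ha := absVertexSum_pos (h2 c) (hn c) hi (off := off c)
  have ha' := absVertexSum_pos (h2 c') (hn c') hi' (off := off c')
  rw [cycleVertexSum_eq (h2 c) (hn c), cycleVertexSum_eq (h2 c') (hn c')] at h
  have habs : absVertexSum r (n c) (off c) c i = absVertexSum r (n c') (off c') c' i' := by
    split_ifs at h <;> omega
  have hsgn : ((i % 2 = 1 ∨ i = 0 ∧ c.val < r) ↔ ¬ (c.val < r ∧ (r + c) % 2 = 1)) ↔
      ((i' % 2 = 1 ∨ i' = 0 ∧ c'.val < r) ↔ ¬ (c'.val < r ∧ (r + c') % 2 = 1)) := by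
    split_ifs at h with h1 h3 h3
    · exact iff_of_true h1 h3
    · omega
    · omega
    · exact iff_of_false h1 h3
  rcases hcc.lt_or_eq with hlt' | rfl
  · exfalso
    have l := hlt c c' hlt'
    rw [Fin.lt_def] at hlt'
    by_cases hc' : c'.val < r
    · have hc : c.val < r := by omega
      have l' := l
      rw [reservedLabels, if_pos hc] at l'
      obtain ⟨rfl, rfl, hne⟩ := absVertexSum_ne_of_lt_of_lt hc' hlt' (h2 c) (h2 c')
        ((hn c).1 hc) ((hn c').1 hc') (hoff c) (hpar c hc) (hpar c' hc') l' hi hi' habs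
      -- The two cycles have opposite orientations, as `r + c` and `r + c'` differ in parity, so the
      -- equal absolute values carry opposite signs.
      simp only [Nat.zero_mod, zero_ne_one, true_and, false_or, hc, hc', true_iff] at hsgn
      omega
    · have hn' : n c' % 2 = 0 := by have := hn c'; omega
      exact (absVertexSum_lt_of_le (not_lt.1 hc') (h2 c) (h2 c') (hn c) hn' (hoff c) l hi
        hi').ne habs
  · refine ⟨rfl, ?_⟩
    by_cases hc : c.val < r
    · exact absVertexSum_injective_of_lt hc (h2 c) ((hn c).1 hc) (hoff c) (hpar c hc) hi hi' habs
    · have hn' : n c % 2 = 0 := by have := hn c; omega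
      refine absVertexSum_injective_of_le (not_lt.1 hc) (h2 c) hn' hi hi' ?_ habs
      simp only [hc, and_false, or_false, false_and, not_false_eq_true, iff_true] at hsgn
      omega

theorem cycleVertexSum_injective (h2 : ∀ c, 2 ≤ n c)
    (hn : ∀ c : Fin N, c.val < r ↔ n c % 2 = 1) (hoff : ∀ c, 3 * r ≤ off c)
    (hpar : ∀ c : Fin N, c.val < r → off c % 2 = r % 2)
    (hlt : ∀ c c' : Fin N, c < c' → off c + reservedLabels r (n c) c ≤ off c')
    {c c' : Fin N} {i i' : ℕ} (hi : i < n c) (hi' : i' < n c')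
    (h : cycleVertexSum r (n c) (off c) c i = cycleVertexSum r (n c') (off c') c' i') :
    c = c' ∧ i = i' := by
  rcases le_total c c' with hcc | hcc
  · exact cycleVertexSum_injective_of_le h2 hn hoff hpar hlt hcc hi hi' h
  · obtain ⟨h1, h3⟩ := cycleVertexSum_injective_of_le h2 hn hoff hpar hlt hcc hi' hi h.symm
    exact ⟨h1.symm, h3.symm⟩

theorem sum_eq_three_mul_add_sum_reservedLabels (hrN : r ≤ N) (h2 : ∀ c, 2 ≤ n c)
    (hn : ∀ c : Fin N, c.val < r ↔ n c % 2 = 1) :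
    ∑ c, n c = 3 * r + ∑ c, reservedLabels r (n c) c := by
  have h1 (c : Fin N) : n c = (if c.val < r then 3 else 0) + reservedLabels r (n c) c := by
    have := h2 c
    have := hn c
    unfold reservedLabels
    split_ifs <;> omega
  have h3 : ∑ c : Fin N, (if c.val < r then 3 else 0) = 3 * r := by
    rw [Finset.sum_ite, Finset.sum_const_zero, add_zero, Finset.sum_const, smul_eq_mul,
      Fin.card_filter_val_lt, min_eq_right hrN, mul_comm]
  rw [← h3, ← Finset.sum_add_distrib]
  exact Finset.sum_congr rfl fun c _ => h1 c

variable {V : Type*} [Fintype V] [DecidableEq V] {G : SimpleGraph V} [DecidableRel G.Adj]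

theorem Trail.edges_of_length_eq_one {t : Trail V} (h : t.darts.length = 1) :
    t.edges = {s(t.src, t.tgt)} := by
  obtain ⟨u, w, l, hne, hch⟩ := t
  obtain ⟨d, rfl⟩ := List.length_eq_one_iff.1 h
  obtain ⟨rfl, rfl⟩ : d.1 = u ∧ d.2 = w := hch
  rfl

theorem hasAntimagicOrientation_of_two (hG : G.IsRegularOfDegree 2) :
    G.HasAntimagicOrientation := by
  obtain ⟨N, r, n, T, hrN, h2, hr, hT, hbij, hcyc, -, -⟩ :=
    exists_cyclic_trails (k := 1) le_rfl hG
  have hn (c : Fin N) : c.val < r ↔ n c % 2 = 1 := (hr c).trans Nat.odd_iff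
  have hcard : Fintype.card (Σ c, Fin (n c)) = ∑ c, n c := by simp
  -- There are as many pieces as vertices, and as many vertices as edges, so every piece is a single
  -- arc.
  have hlen (t) : (T t).darts.length = 1 := by
    have h1 : ∑ t, (T t).darts.length = ∑ t : (Σ c, Fin (n c)), 1 := by
      have hE : ∑ t, (T t).darts.length = #G.edgeFinset := by
        rw [← Finset.card_val, ← hT, Multiset.card_sum]
        simp [Trail.edges]
      have h3 := G.sum_degrees_eq_twice_card_edges
      simp only [hG.degree_eq, Finset.sum_const, smul_eq_mul] at h3
      have h4 := Fintype.card_of_bijective hbij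
      rw [hE, Finset.sum_const, smul_eq_mul, Finset.card_univ, h4]
      rw [Finset.card_univ] at h3
      omega
    exact ((Finset.sum_eq_sum_iff_of_le fun t _ => (T t).length_pos).1 h1.symm t
      (mem_univ t)).symm
  let res : Fin N → ℕ := fun c => reservedLabels r (n c) c
  let off : Fin N → ℕ := fun c => 3 * r + ∑ c' with c' < c, res c'
  have hoff (c) : 3 * r ≤ off c := Nat.le_add_right _ _
  have hoff' (c : Fin N) : off c + res c = 3 * r + ∑ c' with c' ≤ c, res c' := by
    have : (univ.filter fun c' => c' ≤ c) = insert c (univ.filter fun c' => c' < c) := by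
      ext x
      simp [le_iff_eq_or_lt]
    rw [this, Finset.sum_insert (by simp)]
    simp only [off]
    ring
  have htot := sum_eq_three_mul_add_sum_reservedLabels hrN h2 hn
  have hle (c : Fin N) : off c + res c ≤ ∑ c, n c := by
    rw [hoff', htot]
    exact Nat.add_le_add_left (Finset.sum_le_sum_of_subset (Finset.subset_univ _)) _
  have hlt (c c' : Fin N) (h : c < c') : off c + res c ≤ off c' := by
    rw [hoff']
    refine Nat.add_le_add_left (Finset.sum_le_sum_of_subset fun x hx => ?_) _
    simp only [Finset.mem_filter, mem_univ, true_and] at hx ⊢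
    exact hx.trans_lt h
  -- Odd cycles reserve `n - 3` labels, an even number, so their offsets keep the parity of `3 * r`.
  have hpar (c : Fin N) (hc : c.val < r) : off c % 2 = r % 2 := by
    have : 2 ∣ ∑ c' with c' < c, res c' := by
      refine Finset.dvd_sum fun c' hc' => ?_
      have hlt' : c' < c := (Finset.mem_filter.1 hc').2
      rw [Fin.lt_def] at hlt'
      have hc'r : c'.val < r := by omega
      have := (hn c').1 hc'r
      simp only [res, reservedLabels, if_pos hc'r]
      omega
    simp only [off]
    omega
  let num : (Σ c, Fin (n c)) → ℕ := fun t => cycleLabel r (n t.1) (off t.1) t.1 t.2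
  let a : (Σ c, Fin (n c)) → V × V := fun t =>
    if IsBackward r t.1 t.2 then ((T t).tgt, (T t).src) else ((T t).src, (T t).tgt)
  have ha : ∑ t, ({s((a t).1, (a t).2)} : Multiset (Sym2 V)) = G.edgeFinset.val := by
    rw [← hT]
    refine Finset.sum_congr rfl fun t _ => ?_
    rw [Trail.edges_of_length_eq_one (hlen t)]
    simp only [a]
    split_ifs
    · rw [Sym2.eq_swap]
    · rfl
  have hinj : Function.Injective num := by
    rintro ⟨c, i⟩ ⟨c', i'⟩ h
    obtain ⟨rfl, h3⟩ := cycleLabel_injective hr hoff hlt i.2 i'.2 h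
    obtain rfl : i = i' := Fin.ext h3
    rfl
  obtain ⟨D, label, hD, hl, hs⟩ := exists_orientation_of_arcs a ha num hinj fun t => by
    rw [hcard]
    exact cycleLabel_mem_Icc (h2 _) (hr _) t.2.2 (by omega) (hle t.1)
  have hval (c : Fin N) (i : Fin (n c)) :
      D.vertexSum label (T ⟨c, i⟩).src = cycleVertexSum r (n c) (off c) c i := by
    rw [hs]
    have hsum := sum_ends_cyclic T hbij.1 hcyc
      (fun t => if IsBackward r t.1 t.2 then -(num t : ℤ) else num t)
      (fun t => if IsBackward r t.1 t.2 then (num t : ℤ) else -num t) c i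
    convert hsum using 1
    · refine Finset.sum_congr rfl fun t _ => ?_
      simp only [a]
      by_cases hb : IsBackward r t.1 t.2
      · simp only [hb, if_true]
        split_ifs <;> ring
      · simp only [hb, if_false]
        split_ifs <;> ring
    · rfl
  refine ⟨D, hD, label, hl, fun u w huw => ?_⟩
  obtain ⟨⟨c, i⟩, rfl⟩ := hbij.2 u
  obtain ⟨⟨c', i'⟩, rfl⟩ := hbij.2 w
  simp only at huw ⊢
  rw [hval, hval] at huw
  obtain ⟨rfl, hii⟩ := cycleVertexSum_injective h2 hn hoff hpar hlt i.2 i'.2 huw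
  obtain rfl : i = i' := Fin.ext hii
  rfl

end TwoRegular

theorem corollary4 {V : Type*} [Fintype V] (G : SimpleGraph V) [DecidableRel G.Adj]
    (d : ℕ) (hd : 1 ≤ d) (hG : G.IsRegularOfDegree d) :
    G.HasAntimagicOrientation := by
  classical
  rcases Nat.even_or_odd d with h | h
  · obtain ⟨k, rfl⟩ := even_iff_two_dvd.1 h
    rcases Nat.lt_or_ge k 2 with hk | hk
    · obtain rfl : k = 1 := by omega
      exact hasAntimagicOrientation_of_two hG
    · exact hasAntimagicOrientation_of_even hk hG
  · exact hasAntimagicOrientation_of_odd ⟨d, h, hG⟩
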